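/- Let $G_0$ be the complete graph on $\{(0,0),(1,0),(0,1)\}\subset\mathbb{Z}^2$, and let $G_{k+1}$ be the union of the translates of $G_k$ by $(0,0)$, $(2^k,0)$ and $(0,2^k)$. Put $\mathsf{SG}^+=\bigcup_{k\ge 0}G_k$ and $\mathsf{SG}=\mathsf{SG}^+\cup(-\mathsf{SG}^+)$, the doubly infinite Sierpinski gasket graph (a $4$-regular graph), with origin $o=(0,0)$ and neighbour relation $\sim$. For an integer $r$ let $B_r$ be the set of vertices at graph distance at most $r$ from $o$ (so $B_r=\emptyset$ for $r<0$), let $\partial A=\{u\in A:\exists v\notin A,\ u\sim v\}$, and let $b_k=|B_k|-\tfrac12|\partial B_k|$ for integers $k\ge 0$; in particular $b_0=\tfrac12$. Divisible sandpile with height function $1$: put $\Delta f(x)=\tfrac14\sum_{y\sim x}f(y)-f(x)$ and $T_x\mu=\mu+\max\{\mu(x)-1,0\}\,\Delta\delta_x$. For $m\ge 0$ and a sequence $x_1,x_2,\dots$ of vertices containing each vertex of $\mathsf{SG}$ infinitely often, let $\mu_0=m\delta_o$, $\mu_k=T_{x_k}\mu_{k-1}$, and $u_k(y)=\sum_{1\le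 j\le k,\ x_j=y}\big(\mu_{j-1}(y)-\mu_j(y)\big)$, the mass emitted from $y$ in the first $k$ topplings. **Theorem.** Let $m\ge 0$. There is a function $u:\mathsf{SG}\to\mathbb{R}$, the odometer function, such that $u_k\to u$ pointwise for every such sequence $(x_k)$. Let $S_m=\{z\in\mathsf{SG}:u(z)>0\}$ be the sandpile cluster. If $m\ge\tfrac12$, then $n=\max\{k\ge 0:b_k\le m\}$ exists and $$B_{n-1}\subseteq S_m\subseteq B_n .$$ If $m<\tfrac12$ (so that no $k\ge0$ satisfies $b_k\le m$), then $S_m=\emptyset$. -/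

import Mathlib

open Filter Topology

namespace Gasket

/-! ### The doubly infinite graphical Sierpinski gasket -/

/-- The three vertices `(0,0)`, `(1,0)`, `(0,1)` of the initial triangle. -/
def baseTriangle : Set (ℤ × ℤ) := {(0, 0), (1, 0), (0, 1)}

/-- The translation vectors `(0,0)`, `(2^k,0)`, `(0,2^k)`. -/
def shift (k : ℕ) : Fin 3 → ℤ × ℤ := ![(0, 0), (2 ^ k, 0), (0, 2 ^ k)]

/-- The vertex set of the `k`-th finite gasket graph `G_k`. -/
def iterVerts : ℕ → Set (ℤ × ℤ)
  | 0 => baseTriangle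
  | k + 1 => ⋃ i : Fin 3, (fun v => v + shift k i) '' iterVerts k

/-- The edges of `G_k`, as a graph on `ℤ × ℤ`: `G_0` is the complete graph on the base triangle,
and `G_{k+1}` is the union of the three translates of `G_k`. -/
def iterGraph : ℕ → SimpleGraph (ℤ × ℤ)
  | 0 => SimpleGraph.fromRel fun u v => u ∈ baseTriangle ∧ v ∈ baseTriangle
  | k + 1 => ⨆ i : Fin 3, (iterGraph k).map (Equiv.addRight (shift k i)).toEmbedding

/-- The vertices of the one-sided gasket `SG⁺ = ⋃ G_k`. -/
def plusVerts : Set (ℤ × ℤ) := ⋃ k, iterVerts k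

/-- The edges of the one-sided gasket `SG⁺ = ⋃ G_k`. -/
def plusGraph : SimpleGraph (ℤ × ℤ) := ⨆ k, iterGraph k

/-- The vertices of `SG = SG⁺ ∪ (-SG⁺)`. -/
def verts : Set (ℤ × ℤ) := plusVerts ∪ (fun v => -v) '' plusVerts

/-- The edges of `SG = SG⁺ ∪ (-SG⁺)`, as a graph on `ℤ × ℤ`. -/
def fullGraph : SimpleGraph (ℤ × ℤ) :=
  plusGraph ⊔ plusGraph.map (Equiv.neg (ℤ × ℤ)).toEmbedding

/-- The double-sided graphical Sierpinski gasket, as a graph on its own vertex set. -/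
def SG : SimpleGraph verts := fullGraph.induce verts

theorem zero_mem_verts : ((0, 0) : ℤ × ℤ) ∈ verts :=
  Or.inl (Set.mem_iUnion.2 ⟨0, Or.inl rfl⟩)

/-- The origin `o = (0,0)`. -/
def origin : verts := ⟨(0, 0), zero_mem_verts⟩

/-! ### Local finiteness, so that sums over neighbours are finite sums -/

theorem iterGraph_adj_bound (k : ℕ) (u v : ℤ × ℤ) (h : (iterGraph k).Adj u v) :
    |v.1 - u.1| ≤ 1 ∧ |v.2 - u.2| ≤ 1 := by
  induction k generalizing u v with
  | zero =>
    simp only [iterGraph, SimpleGraph.fromRel_adj, baseTriangle, Set.mem_insert_iff,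
      Set.mem_singleton_iff] at h
    obtain ⟨-, ⟨hu, hv⟩ | ⟨hv, hu⟩⟩ := h <;>
      rcases hu with rfl | rfl | rfl <;> rcases hv with rfl | rfl | rfl <;> simp
  | succ k ih =>
    simp only [iterGraph, SimpleGraph.iSup_adj, SimpleGraph.map_adj] at h
    obtain ⟨i, u', v', h', rfl, rfl⟩ := h
    simpa using ih u' v' h'

theorem SG_adj_bound (u v : verts) (h : SG.Adj u v) :
    |v.1.1 - u.1.1| ≤ 1 ∧ |v.1.2 - u.1.2| ≤ 1 := by
  have h' : fullGraph.Adj u.1 v.1 := h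
  rw [fullGraph, SimpleGraph.sup_adj, SimpleGraph.map_adj] at h'
  rcases h' with h' | ⟨a, b, h', ha, hb⟩
  · obtain ⟨k, hk⟩ := SimpleGraph.iSup_adj.1 h'
    exact iterGraph_adj_bound k _ _ hk
  · obtain ⟨k, hk⟩ := SimpleGraph.iSup_adj.1 h'
    have := iterGraph_adj_bound k _ _ hk
    rw [← ha, ← hb]
    simp only [Equiv.coe_toEmbedding, Equiv.neg_apply, Prod.fst_neg, Prod.snd_neg, abs_le] at this ⊢
    omega

theorem finite_neighborSet (u : verts) : (SG.neighborSet u).Finite := by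
  have hf : (Set.Icc (u.1.1 - 1) (u.1.1 + 1) ×ˢ Set.Icc (u.1.2 - 1) (u.1.2 + 1)).Finite :=
    (Set.finite_Icc _ _).prod (Set.finite_Icc _ _)
  refine (hf.preimage (f := (Subtype.val : verts → ℤ × ℤ))
    Subtype.val_injective.injOn).subset ?_
  intro v hv
  have := SG_adj_bound u v hv
  simp only [abs_le] at this
  simp only [Set.mem_preimage, Set.mem_prod, Set.mem_Icc]
  omega

noncomputable instance : SG.LocallyFinite := fun u => (finite_neighborSet u).fintype

/-! ### Balls -/

/-- The ball `B_r` of radius `r` about the origin in the graph metric (empty for `r < 0`). -/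
def ball (r : ℤ) : Set verts := {v | SG.Reachable origin v ∧ (SG.dist origin v : ℤ) ≤ r}

/-- The inner boundary `∂A = {u ∈ A : u ∼ v for some v ∉ A}`. -/
def innerBoundary (A : Set verts) : Set verts := {u | u ∈ A ∧ ∃ v, v ∉ A ∧ SG.Adj u v}

/-- `b_k = |B_k| - ½ |∂B_k|`. -/
noncomputable def ballMass (k : ℕ) : ℝ :=
  ((ball k).ncard : ℝ) - 1 / 2 * ((innerBoundary (ball k)).ncard : ℝ)

/-! ### The divisible sandpile -/

/-- The graph Laplacian `Δf(x) = ¼ ∑_{y ∼ x} f(y) - f(x)` of the (4-regular) graph `SG`. -/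
noncomputable def laplacian (f : verts → ℝ) (x : verts) : ℝ :=
  1 / 4 * ∑ y ∈ SG.neighborFinset x, f y - f x

/-- The toppling operator `T_x μ = μ + max {μ(x) - h(x), 0} Δδ_x` with height function `h`. -/
noncomputable def topple (h : verts → ℝ) (x : verts) (μ : verts → ℝ) : verts → ℝ :=
  fun y => μ y + max (μ x - h x) 0 * laplacian (Pi.single x 1) y

/-- A toppling sequence contains every vertex infinitely often. -/
def IsTopplingSeq (x : ℕ → verts) : Prop := ∀ v : verts, {k : ℕ | x k = v}.Infinite

/-- The sand distribution after `k` topplings; step `k + 1` topples the vertex `x k`. -/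
noncomputable def sand (h μ₀ : verts → ℝ) (x : ℕ → verts) : ℕ → verts → ℝ
  | 0 => μ₀
  | k + 1 => topple h (x k) (sand h μ₀ x k)

/-- The odometer function after `k` topplings: the total mass emitted from `y` during the first
`k` topplings. -/
noncomputable def partialOdometer (h μ₀ : verts → ℝ) (x : ℕ → verts) (k : ℕ) (y : verts) : ℝ :=
  ∑ j ∈ Finset.range k with x j = y, (sand h μ₀ x j y - sand h μ₀ x (j + 1) y)

/-- `u` is the odometer function of the divisible sandpile with initial distribution `μ₀` and height
function `h`: for every toppling sequence the odometer functions converge pointwise to `u`. -/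
def IsOdometer (h μ₀ u : verts → ℝ) : Prop :=
  ∀ x : ℕ → verts, IsTopplingSeq x →
    ∀ y, Tendsto (fun k => partialOdometer h μ₀ x k y) atTop (𝓝 (u y))

/-- The sandpile cluster of the odometer function `u`. -/
def cluster (u : verts → ℝ) : Set verts := {z | 0 < u z}

/-- Toppling sequences exist. -/
theorem exists_isTopplingSeq : ∃ x : ℕ → verts, IsTopplingSeq x := by
  have : Nonempty verts := ⟨origin⟩
  obtain ⟨f, hf⟩ := exists_surjective_nat verts
  refine ⟨fun k => f k.unpair.1, fun v => ?_⟩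
  obtain ⟨a, rfl⟩ := hf v
  refine Set.infinite_of_injective_forall_mem (f := fun n : ℕ => Nat.pair a n) ?_ ?_
  · intro n n' hn
    simpa using hn
  · intro n
    simp

/-- Hence the odometer function is uniquely determined. -/
theorem IsOdometer.unique {h μ₀ u u' : verts → ℝ} (hu : IsOdometer h μ₀ u)
    (hu' : IsOdometer h μ₀ u') : u = u' := by
  obtain ⟨x, hx⟩ := exists_isTopplingSeq
  exact funext fun y => tendsto_nhds_unique (hu x hx y) (hu' x hx y)

end Gasket

/-!
The odometer is the least `u ≥ 0` with `Δu + m δ_o ≤ 1`. If `U ≥ 0` is positive exactly on `B_{n-1}`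
and `ΔU = 1_{B_n} - ½ 1_{∂B_n} - b_n δ_o`, then `U` is such a competitor for every `m ≤ b_n`, so the
cluster lies in `B_{n-1}`, and by the minimum principle `u ≥ U` for every `m ≥ b_n`, so the cluster
contains `B_{n-1}`. For `b_n ≤ m < b_{n+1}`, use the second bound at `n` and the first at `n + 1`.

The function `U` is invariant under `v ↦ -v`, so it is a function on `SG⁺`. There the radius `2n` is
obtained from the radius `n`: doubling the gasket and inserting the midpoints of the sides of each
triangle, one multiplies the old values by `5`, as for harmonic functions on the gasket, and
corrects the values at the midpoints by the constant that makes the equation hold there. The radius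
`2n + 1` is a weighted average of the radii `2n` and `2n + 2`, up to a function of the distance from
the origin. The value of `ΔU` at the origin is then forced by `∑ ΔU = 0`.
-/

namespace Gasket

/-! ### Cells -/

theorem mem_baseTriangle {v : ℤ × ℤ} : v ∈ baseTriangle ↔ 0 ≤ v.1 ∧ 0 ≤ v.2 ∧ v.1 + v.2 ≤ 1 := by
  simp only [baseTriangle, Set.mem_insert_iff, Set.mem_singleton_iff, Prod.ext_iff]
  omega

/-- The lower left corners of the `3 ^ k` unit triangles that make up `G_k`. -/
def iterCells : ℕ → Set (ℤ × ℤ)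
  | 0 => {(0, 0)}
  | k + 1 => ⋃ i : Fin 3, (fun p => p + shift k i) '' iterCells k

/-- The lower left corners of the unit triangles (cells) that make up `SG⁺`; the triangle with
lower left corner `p` has the corners `v` with `v - p ∈ baseTriangle`. -/
def cells : Set (ℤ × ℤ) := ⋃ k, iterCells k

theorem mem_iterVerts_iff {k : ℕ} {v : ℤ × ℤ} :
    v ∈ iterVerts k ↔ ∃ p ∈ iterCells k, v - p ∈ baseTriangle := by
  induction k generalizing v with
  | zero => simp [iterVerts, iterCells, ← Prod.zero_eq_mk]
  | succ k ih =>
    simp only [iterVerts, iterCells, Set.mem_iUnion, Set.mem_image, ih]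
    constructor
    · rintro ⟨i, v, ⟨p, hp, hv⟩, rfl⟩
      exact ⟨p + shift k i, ⟨i, p, hp, rfl⟩, by rwa [add_sub_add_right_eq_sub]⟩
    · rintro ⟨_, ⟨i, p, hp, rfl⟩, hv⟩
      exact ⟨i, v - shift k i, ⟨p, hp, by rwa [sub_sub, add_comm (shift k i)]⟩,
        sub_add_cancel _ _⟩

theorem iterGraph_adj_iff {k : ℕ} {u v : ℤ × ℤ} : (iterGraph k).Adj u v ↔
    u ≠ v ∧ ∃ p ∈ iterCells k, u - p ∈ baseTriangle ∧ v - p ∈ baseTriangle := by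
  induction k generalizing u v with
  | zero => simp [iterGraph, iterCells, ← Prod.zero_eq_mk, SimpleGraph.fromRel_adj, and_comm]
  | succ k ih =>
    simp only [iterGraph, iterCells, SimpleGraph.iSup_adj, SimpleGraph.map_adj, ih,
      Set.mem_iUnion, Set.mem_image]
    constructor
    · rintro ⟨i, u, v, ⟨huv, p, hp, hu, hv⟩, rfl, rfl⟩
      refine ⟨by simpa using huv, p + shift k i, ⟨i, p, hp, rfl⟩, ?_⟩
      simpa only [Equiv.coe_toEmbedding, Equiv.coe_addRight, add_sub_add_right_eq_sub]
        using And.intro hu hv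
    · rintro ⟨huv, _, ⟨i, p, hp, rfl⟩, hu, hv⟩
      refine ⟨i, u - shift k i, v - shift k i, ⟨by simpa using huv, p, hp, ?_⟩, by simp, by simp⟩
      rw [sub_sub, sub_sub, add_comm (shift k i)]
      exact ⟨hu, hv⟩

theorem mem_plusVerts_iff {v : ℤ × ℤ} :
    v ∈ plusVerts ↔ ∃ p ∈ cells, v - p ∈ baseTriangle := by
  simp only [plusVerts, cells, Set.mem_iUnion, mem_iterVerts_iff]
  tauto

theorem plusGraph_adj_iff {u v : ℤ × ℤ} : plusGraph.Adj u v ↔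
    u ≠ v ∧ ∃ p ∈ cells, u - p ∈ baseTriangle ∧ v - p ∈ baseTriangle := by
  simp only [plusGraph, cells, SimpleGraph.iSup_adj, Set.mem_iUnion, iterGraph_adj_iff]
  tauto

theorem mem_iterCells_succ {k : ℕ} {x y : ℤ} : (x, y) ∈ iterCells (k + 1) ↔
    (x, y) ∈ iterCells k ∨ (x - 2 ^ k, y) ∈ iterCells k ∨ (x, y - 2 ^ k) ∈ iterCells k := by
  simp [iterCells, shift, Fin.exists_fin_succ, sub_eq_add_neg]

theorem nonneg_of_mem_cells {x y : ℤ} (h : (x, y) ∈ cells) : 0 ≤ x ∧ 0 ≤ y := by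
  obtain ⟨k, hk⟩ := Set.mem_iUnion.1 h
  induction k generalizing x y with
  | zero => simp_all [iterCells]
  | succ k ih =>
    have hpos : (0 : ℤ) < 2 ^ k := by positivity
    rcases mem_iterCells_succ.1 hk with hk | hk | hk <;>
      (have := ih (Set.mem_iUnion_of_mem k hk) hk; omega)

theorem two_mul_add_mem_iterCells_succ {k : ℕ} {x y i j : ℤ} (hi : i = 0 ∨ i = 1)
    (hj : j = 0 ∨ j = 1) : (2 * x + i, 2 * y + j) ∈ iterCells (k + 1) ↔
      (x, y) ∈ iterCells k ∧ ¬(i = 1 ∧ j = 1) := by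
  induction k generalizing x y with
  | zero =>
    rw [mem_iterCells_succ]
    simp only [iterCells, pow_zero, Set.mem_singleton_iff, Prod.mk.injEq]
    omega
  | succ k ih =>
    have hdigit (z l : ℤ) : 2 * z + l - 2 ^ (k + 1) = 2 * (z - 2 ^ k) + l := by ring
    rw [mem_iterCells_succ, hdigit, hdigit, ih, ih, ih, mem_iterCells_succ (k := k)]
    tauto

/-- The recursion for `iterCells` fixes the leading binary digits of the coordinates; this is the
same recursion at the other end, where it becomes a self-similarity of `cells`. -/
theorem two_mul_add_mem_cells {x y i j : ℤ} (hi : i = 0 ∨ i = 1) (hj : j = 0 ∨ j = 1) :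
    (2 * x + i, 2 * y + j) ∈ cells ↔ (x, y) ∈ cells ∧ ¬(i = 1 ∧ j = 1) := by
  have hsucc {p : ℤ × ℤ} : p ∈ cells ↔ ∃ k, p ∈ iterCells (k + 1) := by
    refine Set.mem_iUnion.trans ⟨fun ⟨k, hk⟩ => ⟨k, ?_⟩, fun ⟨k, hk⟩ => ⟨k + 1, hk⟩⟩
    exact mem_iterCells_succ.2 (Or.inl hk)
  simp only [hsucc, two_mul_add_mem_iterCells_succ hi hj]
  rw [exists_and_right, ← Set.mem_iUnion, ← cells, hsucc]

theorem zero_mem_cells : ((0, 0) : ℤ × ℤ) ∈ cells := Set.mem_iUnion_of_mem 0 rfl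

@[simp]
theorem even_even_mem_cells {x y : ℤ} : (2 * x, 2 * y) ∈ cells ↔ (x, y) ∈ cells := by
  simpa using two_mul_add_mem_cells (x := x) (y := y) (.inl rfl) (.inl rfl)

@[simp]
theorem odd_even_mem_cells {x y : ℤ} : (2 * x + 1, 2 * y) ∈ cells ↔ (x, y) ∈ cells := by
  simpa using two_mul_add_mem_cells (x := x) (y := y) (.inr rfl) (.inl rfl)

@[simp]
theorem even_odd_mem_cells {x y : ℤ} : (2 * x, 2 * y + 1) ∈ cells ↔ (x, y) ∈ cells := by
  simpa using two_mul_add_mem_cells (x := x) (y := y) (.inl rfl) (.inr rfl)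

@[simp]
theorem odd_odd_notMem_cells {x y : ℤ} : (2 * x + 1, 2 * y + 1) ∉ cells := by
  simpa using two_mul_add_mem_cells (x := x) (y := y) (.inr rfl) (.inr rfl)

theorem axis_mem_cells (j : ℕ) : ((j : ℤ), (0 : ℤ)) ∈ cells := by
  induction j using Nat.evenOddRec with
  | h0 => exact zero_mem_cells
  | h_even j ih => exact mod_cast even_even_mem_cells.2 ih
  | h_odd j ih => exact mod_cast odd_even_mem_cells.2 ih

theorem mem_plusVerts_iff_cells {x y : ℤ} : (x, y) ∈ plusVerts ↔
    (x, y) ∈ cells ∨ (x - 1, y) ∈ cells ∨ (x, y - 1) ∈ cells := by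
  simp only [mem_plusVerts_iff, Prod.exists, Prod.mk_sub_mk, mem_baseTriangle]
  constructor
  · rintro ⟨a, b, hab, h⟩
    obtain ⟨rfl, rfl⟩ | ⟨rfl, rfl⟩ | ⟨rfl, rfl⟩ :
        (a = x ∧ b = y) ∨ (a = x - 1 ∧ b = y) ∨ (a = x ∧ b = y - 1) := by omega
    all_goals tauto
  · rintro (h | h | h) <;> exact ⟨_, _, h, by omega⟩

theorem nonneg_of_mem_plusVerts {x y : ℤ} (h : (x, y) ∈ plusVerts) : 0 ≤ x ∧ 0 ≤ y := by
  rcases mem_plusVerts_iff_cells.1 h with h | h | h <;> have := nonneg_of_mem_cells h <;> omega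


/-! ### Functions on one side of the gasket -/

theorem two_mul_sub_one (x : ℤ) : 2 * x - 1 = 2 * (x - 1) + 1 := by ring

theorem two_mul_add_one_add_one (x : ℤ) : 2 * x + 1 + 1 = 2 * (x + 1) := by ring

/-- The indicator function of `cells`. -/
noncomputable def cellInd (x y : ℤ) : ℝ := cells.indicator 1 (x, y)

theorem cellInd_of_mem {x y : ℤ} (h : (x, y) ∈ cells) : cellInd x y = 1 :=
  Set.indicator_of_mem h _

theorem cellInd_of_notMem {x y : ℤ} (h : (x, y) ∉ cells) : cellInd x y = 0 :=
  Set.indicator_of_notMem h _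

theorem cellInd_congr {x y x' y' : ℤ} (h : (x, y) ∈ cells ↔ (x', y') ∈ cells) :
    cellInd x y = cellInd x' y' := by
  by_cases h' : (x', y') ∈ cells
  · rw [cellInd_of_mem h', cellInd_of_mem (h.2 h')]
  · rw [cellInd_of_notMem h', cellInd_of_notMem (mt h.1 h')]

@[simp]
theorem cellInd_even_even (x y : ℤ) : cellInd (2 * x) (2 * y) = cellInd x y :=
  cellInd_congr even_even_mem_cells

@[simp]
theorem cellInd_odd_even (x y : ℤ) : cellInd (2 * x + 1) (2 * y) = cellInd x y :=
  cellInd_congr odd_even_mem_cells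

@[simp]
theorem cellInd_even_odd (x y : ℤ) : cellInd (2 * x) (2 * y + 1) = cellInd x y :=
  cellInd_congr even_odd_mem_cells

@[simp]
theorem cellInd_odd_odd (x y : ℤ) : cellInd (2 * x + 1) (2 * y + 1) = 0 :=
  cellInd_of_notMem odd_odd_notMem_cells

/-- The sum of `F` over the lower left corners of the three unit triangles with corner `(x, y)`. -/
def sumCells (F : ℤ → ℤ → ℝ) (x y : ℤ) : ℝ := F x y + F (x - 1) y + F x (y - 1)

theorem sumCells_cellInd_even_even (x y : ℤ) :
    sumCells cellInd (2 * x) (2 * y) = sumCells cellInd x y := by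
  simp only [sumCells, two_mul_sub_one, cellInd_even_even, cellInd_odd_even, cellInd_even_odd]

theorem sumCells_cellInd_odd_even (x y : ℤ) :
    sumCells cellInd (2 * x + 1) (2 * y) = 2 * cellInd x y := by
  simp only [sumCells, two_mul_sub_one, add_sub_cancel_right, cellInd_even_even, cellInd_odd_even,
    cellInd_odd_odd]
  ring

theorem sumCells_cellInd_even_odd (x y : ℤ) :
    sumCells cellInd (2 * x) (2 * y + 1) = 2 * cellInd x y := by
  simp only [sumCells, two_mul_sub_one, add_sub_cancel_right, cellInd_even_even, cellInd_even_odd,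
    cellInd_odd_odd]
  ring

theorem sumCells_cellInd_odd_odd (x y : ℤ) :
    sumCells cellInd (2 * x + 1) (2 * y + 1) = 2 * cellInd x y := by
  simp only [sumCells, add_sub_cancel_right, cellInd_odd_even, cellInd_even_odd, cellInd_odd_odd]
  ring

theorem sumCells_cellInd_eq_zero_or_two {x y : ℤ} (h : (x, y) ≠ (0, 0)) :
    sumCells cellInd x y = 0 ∨ sumCells cellInd x y = 2 := by
  have htwo (x y : ℤ) : 2 * cellInd x y = 0 ∨ 2 * cellInd x y = 2 := by
    by_cases h : (x, y) ∈ cells <;> simp [cellInd_of_mem, cellInd_of_notMem, h]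
  induction hn : x.natAbs + y.natAbs using Nat.strong_induction_on generalizing x y with
  | _ n ih =>
    obtain ⟨x, rfl | rfl⟩ := x.even_or_odd' <;> obtain ⟨y, rfl | rfl⟩ := y.even_or_odd'
    · rw [sumCells_cellInd_even_even]
      simp only [ne_eq, Prod.mk.injEq] at h
      exact ih _ (by omega) (by simpa using h) rfl
    · rw [sumCells_cellInd_even_odd]; exact htwo x y
    · rw [sumCells_cellInd_odd_even]; exact htwo x y
    · rw [sumCells_cellInd_odd_odd]; exact htwo x y

theorem sumCells_cellInd_of_mem_plusVerts {x y : ℤ} (hv : (x, y) ∈ plusVerts)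
    (h : (x, y) ≠ (0, 0)) : sumCells cellInd x y = 2 := by
  refine (sumCells_cellInd_eq_zero_or_two h).resolve_left (ne_of_gt ?_)
  have hnonneg (x y : ℤ) : 0 ≤ cellInd x y := Set.indicator_apply_nonneg fun _ => zero_le_one
  have := hnonneg x y
  have := hnonneg (x - 1) y
  have := hnonneg x (y - 1)
  rw [sumCells]
  rcases mem_plusVerts_iff_cells.1 hv with hv | hv | hv <;> linarith [cellInd_of_mem hv]

theorem cellInd_of_neg {x y : ℤ} (h : x < 0 ∨ y < 0) : cellInd x y = 0 :=
  cellInd_of_notMem fun hc => by have := nonneg_of_mem_cells hc; omega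

theorem sumCells_cellInd_zero : sumCells cellInd 0 0 = 1 := by
  rw [sumCells, cellInd_of_mem zero_mem_cells, cellInd_of_neg (by omega),
    cellInd_of_neg (by omega), add_zero, add_zero]

/-- The sum over the cells with corner `(x, y)` and over the corners `q` of such a cell of
`u q - u (x, y)`. -/
noncomputable def triLap (u : ℤ → ℤ → ℝ) (x y : ℤ) : ℝ :=
  sumCells (fun a b => cellInd a b * (u a b + u (a + 1) b + u a (b + 1) - 3 * u x y)) x y

/-- The number of cells with corner `(x, y)` whose lower left corner has level less than `n`. -/
noncomputable def cellsBelow (n : ℤ) (x y : ℤ) : ℝ :=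
  sumCells (fun a b => if a + b < n then cellInd a b else 0) x y

/-- `u` solves the discrete obstacle problem for radius `n` on `SG⁺`, away from the origin. Divided
by `4`, the equation says that the Laplacian of `u` is `1` below level `n`, vanishes above level
`n`, and on level `n` is half the number of cells that reach it from below. -/
structure IsLevelFun (n : ℤ) (u : ℤ → ℤ → ℝ) : Prop where
  eq_zero : ∀ {x y}, (x, y) ∈ plusVerts → n ≤ x + y → u x y = 0
  le : ∀ {x y}, (x, y) ∈ plusVerts → 2 * (n - x - y) ≤ u x y
  eq_two : ∀ {x y}, (x, y) ∈ cells → x + y + 1 = n → u x y = 2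
  triLap_eq : ∀ {x y}, (x, y) ≠ (0, 0) → triLap u x y = 2 * cellsBelow n x y

/-- The refinement of `w` by the values `5a`, `5b`, `5c` at the corners of a doubled cell and
`2a + 2b + c - s`, `2a + b + 2c - s`, `a + 2b + 2c - s` at the midpoints of its sides, where `a`,
`b`, `c` are the values of `w` at the corners of the original cell and `s = 2` if this cell lies
below level `n` and `s = 0` otherwise. -/
noncomputable def refinement (n : ℤ) (w : ℤ → ℤ → ℝ) (X Y : ℤ) : ℝ :=
  let x := X / 2
  let y := Y / 2
  let s := if x + y < n then 2 else 0
  if Even X then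
    if Even Y then 5 * w x y else 2 * w x y + w (x + 1) y + 2 * w x (y + 1) - s
  else
    if Even Y then 2 * w x y + 2 * w (x + 1) y + w x (y + 1) - s
    else w x y + 2 * w (x + 1) y + 2 * w x (y + 1) - s

section Refinement

variable (n : ℤ) (w : ℤ → ℤ → ℝ) (x y : ℤ)

theorem two_mul_add_one_ediv_two : (2 * x + 1) / 2 = x := by omega

theorem refinement_even_even : refinement n w (2 * x) (2 * y) = 5 * w x y := by
  simp [refinement]

theorem refinement_odd_even : refinement n w (2 * x + 1) (2 * y) =
    2 * w x y + 2 * w (x + 1) y + w x (y + 1) - if x + y < n then 2 else 0 := by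
  simp [refinement, two_mul_add_one_ediv_two]

theorem refinement_even_odd : refinement n w (2 * x) (2 * y + 1) =
    2 * w x y + w (x + 1) y + 2 * w x (y + 1) - if x + y < n then 2 else 0 := by
  simp [refinement, two_mul_add_one_ediv_two]

theorem refinement_odd_odd : refinement n w (2 * x + 1) (2 * y + 1) =
    w x y + 2 * w (x + 1) y + 2 * w x (y + 1) - if x + y < n then 2 else 0 := by
  simp only [refinement, two_mul_add_one_ediv_two, Int.not_even_two_mul_add_one, if_false]

theorem even_add_even_lt : 2 * x + 2 * y < 2 * n ↔ x + y < n := by omega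

theorem odd_add_even_lt : 2 * x + 1 + 2 * y < 2 * n ↔ x + y < n := by omega

theorem even_add_odd_lt : 2 * x + (2 * y + 1) < 2 * n ↔ x + y < n := by omega

theorem cellsBelow_even_even : cellsBelow (2 * n) (2 * x) (2 * y) = cellsBelow n x y := by
  simp only [cellsBelow, sumCells, two_mul_sub_one, cellInd_even_even, cellInd_odd_even,
    cellInd_even_odd, even_add_even_lt, odd_add_even_lt, even_add_odd_lt]

theorem triLap_refinement_even_even : triLap (refinement n w) (2 * x) (2 * y) =
    3 * triLap w x y - 4 * cellsBelow n x y := by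
  simp only [triLap, cellsBelow, sumCells, two_mul_sub_one, two_mul_add_one_add_one,
    sub_add_cancel, cellInd_even_even, cellInd_odd_even, cellInd_even_odd, refinement_even_even,
    refinement_odd_even, refinement_even_odd, refinement_odd_odd]
  split_ifs <;> ring

theorem triLap_refinement_odd_even : triLap (refinement n w) (2 * x + 1) (2 * y) =
    2 * cellsBelow (2 * n) (2 * x + 1) (2 * y) := by
  simp only [triLap, cellsBelow, sumCells, two_mul_sub_one, two_mul_add_one_add_one,
    add_sub_cancel_right, cellInd_even_even, cellInd_odd_even, cellInd_odd_odd,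
    refinement_even_even, refinement_odd_even, refinement_even_odd, refinement_odd_odd,
    even_add_even_lt, odd_add_even_lt, zero_mul, ite_self]
  split_ifs <;> ring

theorem triLap_refinement_even_odd : triLap (refinement n w) (2 * x) (2 * y + 1) =
    2 * cellsBelow (2 * n) (2 * x) (2 * y + 1) := by
  simp only [triLap, cellsBelow, sumCells, two_mul_sub_one, two_mul_add_one_add_one,
    add_sub_cancel_right, cellInd_even_even, cellInd_even_odd, cellInd_odd_odd,
    refinement_even_even, refinement_odd_even, refinement_even_odd, refinement_odd_odd,
    even_add_even_lt, even_add_odd_lt, zero_mul, ite_self]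
  split_ifs <;> ring

theorem triLap_refinement_odd_odd : triLap (refinement n w) (2 * x + 1) (2 * y + 1) =
    2 * cellsBelow (2 * n) (2 * x + 1) (2 * y + 1) := by
  simp only [triLap, cellsBelow, sumCells, two_mul_add_one_add_one, add_sub_cancel_right,
    cellInd_odd_even, cellInd_even_odd, cellInd_odd_odd, refinement_even_even, refinement_odd_even,
    refinement_even_odd, refinement_odd_odd, odd_add_even_lt, even_add_odd_lt, zero_mul, ite_self]
  split_ifs <;> ring

end Refinement

@[simp]
theorem even_even_mem_plusVerts {x y : ℤ} : (2 * x, 2 * y) ∈ plusVerts ↔ (x, y) ∈ plusVerts := by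
  simp [mem_plusVerts_iff_cells, two_mul_sub_one]

@[simp]
theorem odd_even_mem_plusVerts {x y : ℤ} : (2 * x + 1, 2 * y) ∈ plusVerts ↔ (x, y) ∈ cells := by
  simp [mem_plusVerts_iff_cells, two_mul_sub_one]

@[simp]
theorem even_odd_mem_plusVerts {x y : ℤ} : (2 * x, 2 * y + 1) ∈ plusVerts ↔ (x, y) ∈ cells := by
  simp [mem_plusVerts_iff_cells, two_mul_sub_one]

@[simp]
theorem odd_odd_mem_plusVerts {x y : ℤ} : (2 * x + 1, 2 * y + 1) ∈ plusVerts ↔ (x, y) ∈ cells := by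
  simp [mem_plusVerts_iff_cells]

theorem mem_cells_of_odd_level {x y : ℤ} (hv : (x, y) ∈ plusVerts) (h : ¬2 ∣ x + y) :
    (x, y) ∈ cells := by
  obtain ⟨x, rfl | rfl⟩ := x.even_or_odd' <;> obtain ⟨y, rfl | rfl⟩ := y.even_or_odd'
  · omega
  · simpa using hv
  · simpa using hv
  · omega

theorem cellInd_of_odd_level {x y : ℤ} (h : ¬2 ∣ x + y) :
    cellInd x y = cellInd (x - 1) y + cellInd x (y - 1) := by
  obtain ⟨x, rfl | rfl⟩ := x.even_or_odd' <;> obtain ⟨y, rfl | rfl⟩ := y.even_or_odd'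
  · omega
  · simp [two_mul_sub_one]
  · simp [two_mul_sub_one]
  · omega

theorem corners_mem_plusVerts {x y : ℤ} (h : (x, y) ∈ cells) :
    (x, y) ∈ plusVerts ∧ (x + 1, y) ∈ plusVerts ∧ (x, y + 1) ∈ plusVerts := by
  simp [mem_plusVerts_iff_cells, h]

namespace IsLevelFun

variable {n : ℤ} {w w' : ℤ → ℤ → ℝ}

theorem refinement_eq_zero (hw : IsLevelFun n w) {X Y : ℤ} (hv : (X, Y) ∈ plusVerts)
    (h : 2 * n ≤ X + Y) : refinement n w X Y = 0 := by
  have hzero {x y : ℤ} (hc : (x, y) ∈ cells) (h : n ≤ x + y + 1) :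
      w (x + 1) y = 0 ∧ w x (y + 1) = 0 :=
    ⟨hw.eq_zero (corners_mem_plusVerts hc).2.1 (by omega),
      hw.eq_zero (corners_mem_plusVerts hc).2.2 (by omega)⟩
  have hmid {x y : ℤ} (hc : (x, y) ∈ cells) (h : n ≤ x + y + 1) :
      w x y - (if x + y < n then 2 else 0) = 0 := by
    split_ifs with hlt
    · rw [hw.eq_two hc (by omega), sub_self]
    · rw [hw.eq_zero (corners_mem_plusVerts hc).1 (by omega), sub_zero]
  obtain ⟨x, rfl | rfl⟩ := X.even_or_odd' <;> obtain ⟨y, rfl | rfl⟩ := Y.even_or_odd'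
  · rw [refinement_even_even, hw.eq_zero (even_even_mem_plusVerts.1 hv) (by omega), mul_zero]
  · have hc := even_odd_mem_plusVerts.1 hv
    rw [refinement_even_odd, (hzero hc (by omega)).1, (hzero hc (by omega)).2]
    linarith [hmid hc (by omega), hw.eq_zero (corners_mem_plusVerts hc).1 (by omega)]
  · have hc := odd_even_mem_plusVerts.1 hv
    rw [refinement_odd_even, (hzero hc (by omega)).1, (hzero hc (by omega)).2]
    linarith [hmid hc (by omega), hw.eq_zero (corners_mem_plusVerts hc).1 (by omega)]
  · have hc := odd_odd_mem_plusVerts.1 hv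
    rw [refinement_odd_odd, (hzero hc (by omega)).1, (hzero hc (by omega)).2]
    linarith [hmid hc (by omega)]

theorem refinement_eq_two (hw : IsLevelFun n w) {X Y : ℤ} (hc : (X, Y) ∈ cells)
    (h : X + Y + 1 = 2 * n) : refinement n w X Y = 2 := by
  have hcell {x y : ℤ} (hc : (x, y) ∈ cells) (h : x + y + 1 = n) :
      w x y = 2 ∧ w (x + 1) y = 0 ∧ w x (y + 1) = 0 :=
    ⟨hw.eq_two hc h, hw.eq_zero (corners_mem_plusVerts hc).2.1 (by omega),
      hw.eq_zero (corners_mem_plusVerts hc).2.2 (by omega)⟩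
  obtain ⟨x, rfl | rfl⟩ := X.even_or_odd' <;> obtain ⟨y, rfl | rfl⟩ := Y.even_or_odd'
  · omega
  · obtain ⟨ha, hb, hc⟩ := hcell (even_odd_mem_cells.1 hc) (by omega)
    rw [refinement_even_odd, ha, hb, hc, if_pos (by omega)]
    norm_num
  · obtain ⟨ha, hb, hc⟩ := hcell (odd_even_mem_cells.1 hc) (by omega)
    rw [refinement_odd_even, ha, hb, hc, if_pos (by omega)]
    norm_num
  · exact absurd hc odd_odd_notMem_cells

theorem le_refinement (hw : IsLevelFun n w) {X Y : ℤ} (hv : (X, Y) ∈ plusVerts) :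
    5 * (2 * n - X - Y) - (if 2 ∣ X + Y then 0 else 3) ≤ refinement n w X Y := by
  have hcell {x y : ℤ} (hc : (x, y) ∈ cells) : 2 * (n - x - y) ≤ w x y ∧
      2 * (n - (x + 1) - y) ≤ w (x + 1) y ∧ 2 * (n - x - (y + 1)) ≤ w x (y + 1) := by
    obtain ⟨ha, hb, hc⟩ := corners_mem_plusVerts hc
    have := hw.le hb
    have := hw.le hc
    push_cast at *
    exact ⟨hw.le ha, ‹_›, ‹_›⟩
  have hs (x y : ℤ) : (if x + y < n then 2 else 0 : ℝ) ≤ 2 := by split_ifs <;> norm_num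
  obtain ⟨x, rfl | rfl⟩ := X.even_or_odd' <;> obtain ⟨y, rfl | rfl⟩ := Y.even_or_odd'
  · have := hw.le (even_even_mem_plusVerts.1 hv)
    rw [refinement_even_even, if_pos (by omega)]
    push_cast
    linarith
  · have := hcell (even_odd_mem_plusVerts.1 hv)
    rw [refinement_even_odd, if_neg (by omega)]
    push_cast
    linarith [hs x y]
  · have := hcell (odd_even_mem_plusVerts.1 hv)
    rw [refinement_odd_even, if_neg (by omega)]
    push_cast
    linarith [hs x y]
  · have := hcell (odd_odd_mem_plusVerts.1 hv)
    rw [refinement_odd_odd, if_pos (by omega)]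
    push_cast
    linarith [hs x y]

theorem triLap_refinement (hw : IsLevelFun n w) {X Y : ℤ} (h : (X, Y) ≠ (0, 0)) :
    triLap (refinement n w) X Y = 2 * cellsBelow (2 * n) X Y := by
  obtain ⟨x, rfl | rfl⟩ := X.even_or_odd' <;> obtain ⟨y, rfl | rfl⟩ := Y.even_or_odd'
  · rw [triLap_refinement_even_even, cellsBelow_even_even, hw.triLap_eq (by simpa using h)]
    ring
  · exact triLap_refinement_even_odd ..
  · exact triLap_refinement_odd_even ..
  · exact triLap_refinement_odd_odd ..

protected theorem refinement (hw : IsLevelFun n w) : IsLevelFun (2 * n) (refinement n w) where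
  eq_zero := hw.refinement_eq_zero
  le {x y} hv := by
    rcases le_or_gt (2 * n) (x + y) with h | h
    · rw [hw.refinement_eq_zero hv h]
      have : (2 * n : ℝ) ≤ x + y := mod_cast h
      push_cast
      linarith
    · have hle := hw.le_refinement hv
      have : (x + y + 1 : ℝ) ≤ 2 * n := mod_cast h
      push_cast
      split_ifs at hle <;> linarith
  eq_two := hw.refinement_eq_two
  triLap_eq := hw.triLap_refinement

end IsLevelFun

/-- The excess, as a function of the level, of the refinement of radius `2 * n + 2` plus twice the
refinement of radius `2 * n` over three times the solution of radius `2 * n + 1`. -/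
noncomputable def levelCorrection (n l : ℤ) : ℝ :=
  if l ≤ 2 * n then 4 else if l = 2 * n + 1 then 2 else 0

/-- The solution of radius `2 * n + 1` built from solutions `w`, `w'` of radius `n`, `n + 1`. -/
noncomputable def oddRefinement (n : ℤ) (w w' : ℤ → ℤ → ℝ) (x y : ℤ) : ℝ :=
  (refinement (n + 1) w' x y + 2 * refinement n w x y - levelCorrection n (x + y)) / 3

theorem triLap_oddRefinement (n : ℤ) (w w' : ℤ → ℤ → ℝ) (x y : ℤ) :
    triLap (oddRefinement n w w') x y = (triLap (refinement (n + 1) w') x y +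
      2 * triLap (refinement n w) x y - triLap (fun x y => levelCorrection n (x + y)) x y) / 3 := by
  simp only [triLap, sumCells, oddRefinement]
  ring

theorem triLap_levelCorrection (n x y : ℤ) :
    triLap (fun x y => levelCorrection n (x + y)) x y = 2 * cellsBelow (2 * n + 2) x y +
      4 * cellsBelow (2 * n) x y - 6 * cellsBelow (2 * n + 1) x y := by
  simp only [triLap, cellsBelow, sumCells, levelCorrection]
  obtain h | h | h | h | h : x + y < 2 * n ∨ x + y = 2 * n ∨ x + y = 2 * n + 1 ∨
    x + y = 2 * n + 2 ∨ 2 * n + 2 < x + y := by omega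
  · simp (disch := omega) only [if_pos]
    ring
  · simp (disch := omega) only [if_pos, if_neg]
    ring
  · simp (disch := omega) only [if_pos, if_neg]
    rw [cellInd_of_odd_level (by omega)]
    ring
  · simp (disch := omega) only [if_pos, if_neg]
    ring
  · simp (disch := omega) only [if_neg]
    ring

namespace IsLevelFun

variable {n : ℤ} {w w' : ℤ → ℤ → ℝ}

theorem oddRefinement_eq_zero (hw : IsLevelFun n w) (hw' : IsLevelFun (n + 1) w') {x y : ℤ}
    (hv : (x, y) ∈ plusVerts) (h : 2 * n + 1 ≤ x + y) : oddRefinement n w w' x y = 0 := by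
  rw [oddRefinement, hw.refinement_eq_zero hv (by omega), levelCorrection, if_neg (by omega)]
  split_ifs with hl
  · rw [hw'.refinement_eq_two (mem_cells_of_odd_level hv (by omega)) (by omega)]
    norm_num
  · rw [hw'.refinement_eq_zero hv (by omega)]
    norm_num

theorem oddRefinement_eq_two (hw : IsLevelFun n w) (hw' : IsLevelFun (n + 1) w') {x y : ℤ}
    (hc : (x, y) ∈ cells) (h : x + y + 1 = 2 * n + 1) : oddRefinement n w w' x y = 2 := by
  have hten : refinement (n + 1) w' x y = 10 := by
    obtain ⟨x, rfl | rfl⟩ := x.even_or_odd' <;> obtain ⟨y, rfl | rfl⟩ := y.even_or_odd'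
    · rw [refinement_even_even, hw'.eq_two (even_even_mem_cells.1 hc) (by omega)]
      norm_num
    · omega
    · omega
    · exact absurd hc odd_odd_notMem_cells
  rw [oddRefinement, hten, hw.refinement_eq_zero (corners_mem_plusVerts hc).1 (by omega),
    levelCorrection, if_pos (by omega)]
  norm_num

theorem le_oddRefinement (hw : IsLevelFun n w) (hw' : IsLevelFun (n + 1) w') {x y : ℤ}
    (hv : (x, y) ∈ plusVerts) : 2 * ((2 * n + 1 : ℤ) - x - y) ≤ oddRefinement n w w' x y := by
  rcases le_or_gt (2 * n + 1) (x + y) with h | h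
  · rw [oddRefinement_eq_zero hw hw' hv h]
    have : ((2 * n + 1 : ℤ) : ℝ) ≤ x + y := mod_cast h
    linarith
  · have hle := hw.le_refinement hv
    have hle' := hw'.le_refinement hv
    rw [oddRefinement, levelCorrection, if_pos (by omega)]
    push_cast at *
    split_ifs at hle hle' with heven
    · have : (x + y : ℝ) ≤ 2 * n := mod_cast (by omega : x + y ≤ 2 * n)
      linarith
    · have : (x + y + 1 : ℝ) ≤ 2 * n := mod_cast (by omega : x + y + 1 ≤ 2 * n)
      linarith

protected theorem oddRefinement (hw : IsLevelFun n w) (hw' : IsLevelFun (n + 1) w') :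
    IsLevelFun (2 * n + 1) (oddRefinement n w w') where
  eq_zero := hw.oddRefinement_eq_zero hw'
  le := hw.le_oddRefinement hw'
  eq_two := hw.oddRefinement_eq_two hw'
  triLap_eq h := by
    rw [triLap_oddRefinement, hw.triLap_refinement h, hw'.triLap_refinement h,
      triLap_levelCorrection, mul_add_one]
    ring

end IsLevelFun

theorem isLevelFun_zero : IsLevelFun 0 fun _ _ => 0 where
  eq_zero _ _ := rfl
  le {x y} hv := by
    have := nonneg_of_mem_plusVerts hv
    have : (0 : ℝ) ≤ x + y := mod_cast (by omega : 0 ≤ x + y)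
    push_cast
    linarith
  eq_two hc _ := by
    have := nonneg_of_mem_cells hc
    omega
  triLap_eq {x y} _ := by
    simp only [triLap, cellsBelow, sumCells]
    have hbelow (x y : ℤ) : (if x + y < 0 then cellInd x y else 0) = 0 :=
      ite_eq_right_iff.2 fun h => cellInd_of_neg (by omega)
    simp [hbelow]

theorem isLevelFun_one : IsLevelFun 1 fun x y => if x + y < 1 then 2 else 0 where
  eq_zero _ h := if_neg (by omega)
  le {x y} hv := by
    have := nonneg_of_mem_plusVerts hv
    have : (0 : ℝ) ≤ x + y := mod_cast (by omega : 0 ≤ x + y)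
    split_ifs with h
    · push_cast
      linarith
    · have : (1 : ℝ) ≤ x + y := mod_cast (by omega : 1 ≤ x + y)
      push_cast
      linarith
  eq_two _ h := if_pos (by omega)
  triLap_eq {x y} h := by
    simp only [triLap, cellsBelow, sumCells]
    rcases lt_or_ge (x + y) 1 with hlt | hge
    · have hneg : x < 0 ∨ y < 0 := by
        simp only [ne_eq, Prod.mk.injEq] at h
        omega
      simp [cellInd_of_neg hneg, cellInd_of_neg (x := x - 1) (y := y) (by omega),
        cellInd_of_neg (x := x) (y := y - 1) (by omega)]
    · have hup : ¬x + y < 1 ∧ ¬x + 1 + y < 1 ∧ ¬x + (y + 1) < 1 := by omega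
      have hdown : ¬x - 1 + (y + 1) < 1 ∧ ¬x + 1 + (y - 1) < 1 := by omega
      simp only [hup, hdown, sub_add_cancel, if_false]
      split_ifs <;> ring

theorem exists_isLevelFun (n : ℕ) : ∃ u, IsLevelFun n u := by
  induction n using Nat.strong_induction_on with
  | _ n ih =>
    rcases le_or_gt n 1 with h | h
    · interval_cases n
      exacts [⟨_, isLevelFun_zero⟩, ⟨_, isLevelFun_one⟩]
    obtain ⟨n, rfl | rfl⟩ := n.even_or_odd'
    · obtain ⟨w, hw⟩ := ih n (by omega)
      exact ⟨_, mod_cast hw.refinement⟩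
    · obtain ⟨w, hw⟩ := ih n (by omega)
      obtain ⟨w', hw'⟩ := ih (n + 1) (by omega)
      exact ⟨_, mod_cast hw.oddRefinement (mod_cast hw')⟩


/-! ### Folding the gasket onto one side -/

theorem mem_verts_iff {v : ℤ × ℤ} : v ∈ verts ↔ v ∈ plusVerts ∨ -v ∈ plusVerts := by
  rw [verts, Set.image_neg_eq_neg, Set.mem_union, Set.mem_neg]

theorem fullGraph_adj_iff {u v : ℤ × ℤ} :
    fullGraph.Adj u v ↔ plusGraph.Adj u v ∨ plusGraph.Adj (-u) (-v) := by
  rw [fullGraph, SimpleGraph.sup_adj]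
  refine or_congr_right ⟨?_, fun h => ?_⟩
  · rintro ⟨-, u, v, h, rfl, rfl⟩
    simpa using h
  · exact (SimpleGraph.map_adj ..).2 ⟨_, _, h, neg_neg u, neg_neg v⟩

theorem mem_plusVerts_of_adj {u v : ℤ × ℤ} (h : plusGraph.Adj u v) : u ∈ plusVerts := by
  obtain ⟨-, p, hp, hu, -⟩ := plusGraph_adj_iff.1 h
  exact mem_plusVerts_iff.2 ⟨p, hp, hu⟩

theorem eq_zero_of_mem_of_neg_mem {v : ℤ × ℤ} (h : v ∈ plusVerts) (h' : -v ∈ plusVerts) :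
    v = 0 := by
  have hv := nonneg_of_mem_plusVerts h
  have hv' := nonneg_of_mem_plusVerts h'
  simp only [Left.nonneg_neg_iff] at hv'
  exact Prod.ext (le_antisymm hv'.1 hv.1) (le_antisymm hv'.2 hv.2)

/-- The image of a vertex of `SG` under the folding map `SG → SG⁺` that identifies `v` and `-v`. -/
def fold (v : verts) : ℤ × ℤ := (|v.1.1|, |v.1.2|)

theorem fold_eq_of_mem {v : verts} (h : v.1 ∈ plusVerts) : fold v = v.1 := by
  obtain ⟨hx, hy⟩ := nonneg_of_mem_plusVerts h
  rw [fold, abs_of_nonneg hx, abs_of_nonneg hy]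

theorem fold_eq_neg_of_neg_mem {v : verts} (h : -v.1 ∈ plusVerts) : fold v = -v.1 := by
  obtain ⟨hx, hy⟩ := nonneg_of_mem_plusVerts h
  rw [fold, ← abs_neg v.1.1, ← abs_neg v.1.2, abs_of_nonneg hx, abs_of_nonneg hy]
  rfl

theorem fold_mem_plusVerts (v : verts) : fold v ∈ plusVerts := by
  rcases mem_verts_iff.1 v.2 with h | h
  · rwa [fold_eq_of_mem h]
  · rwa [fold_eq_neg_of_neg_mem h]

theorem fold_eq_zero_iff {v : verts} : fold v = (0, 0) ↔ v = origin := by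
  simp [fold, origin, Subtype.ext_iff, Prod.ext_iff]

theorem fold_eq_or {v : verts} (hv : v ≠ origin) :
    fold v = v.1 ∧ -v.1 ∉ plusVerts ∨ fold v = -v.1 ∧ v.1 ∉ plusVerts := by
  have hne : v.1 ≠ 0 := fun h => hv (Subtype.ext h)
  rcases mem_verts_iff.1 v.2 with h | h
  · exact Or.inl ⟨fold_eq_of_mem h, fun h' => hne (eq_zero_of_mem_of_neg_mem h h')⟩
  · exact Or.inr ⟨fold_eq_neg_of_neg_mem h, fun h' => hne (eq_zero_of_mem_of_neg_mem h' h)⟩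

theorem plusGraph_adj_fold {u v : verts} (h : SG.Adj u v) : plusGraph.Adj (fold u) (fold v) := by
  rcases fullGraph_adj_iff.1 h with h | h
  · rwa [fold_eq_of_mem (mem_plusVerts_of_adj h), fold_eq_of_mem (mem_plusVerts_of_adj h.symm)]
  · rwa [fold_eq_neg_of_neg_mem (mem_plusVerts_of_adj h),
      fold_eq_neg_of_neg_mem (mem_plusVerts_of_adj h.symm)]

theorem exists_adj_fold_eq {v : verts} {p : ℤ × ℤ} (h : plusGraph.Adj (fold v) p) :
    ∃ q, SG.Adj v q ∧ fold q = p := by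
  have hp := mem_plusVerts_of_adj h.symm
  rcases mem_verts_iff.1 v.2 with hv | hv
  · rw [fold_eq_of_mem hv] at h
    exact ⟨⟨p, mem_verts_iff.2 (Or.inl hp)⟩, fullGraph_adj_iff.2 (Or.inl h), fold_eq_of_mem hp⟩
  · rw [fold_eq_neg_of_neg_mem hv] at h
    have hp' : - -p ∈ plusVerts := by rwa [neg_neg]
    refine ⟨⟨-p, mem_verts_iff.2 (Or.inr hp')⟩, fullGraph_adj_iff.2 (Or.inr ?_), ?_⟩
    · exact (neg_neg p).symm ▸ h
    · rw [fold_eq_neg_of_neg_mem hp', neg_neg]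

theorem plusGraph_adj_add_iff {p d e : ℤ × ℤ} (hd : d ∈ baseTriangle) (he : e ∈ baseTriangle)
    (hne : d ≠ e) : plusGraph.Adj (p + d) (p + e) ↔ p ∈ cells := by
  rw [plusGraph_adj_iff]
  constructor
  · rintro ⟨-, q, hq, hd', he'⟩
    have hpq : p = q := by
      simp only [mem_baseTriangle, ne_eq, Prod.ext_iff, Prod.fst_add, Prod.snd_add, Prod.fst_sub,
        Prod.snd_sub] at *
      omega
    rwa [hpq]
  · intro hp
    exact ⟨by simpa using hne, p, hp, by simpa using hd, by simpa using he⟩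

theorem mem_cells_of_adj_of_lt {u v : ℤ × ℤ} (h : plusGraph.Adj u v)
    (hlt : u.1 + u.2 < v.1 + v.2) : u ∈ cells := by
  obtain ⟨-, p, hp, hu, hv⟩ := plusGraph_adj_iff.1 h
  have hup : u = p := by
    simp only [mem_baseTriangle, Prod.ext_iff, Prod.fst_sub, Prod.snd_sub] at *
    omega
  rwa [hup]

theorem exists_plusGraph_adj_add_one_eq {x y : ℤ} (hv : (x, y) ∈ plusVerts)
    (h : (x, y) ≠ (0, 0)) : ∃ p, plusGraph.Adj (x, y) p ∧ p.1 + p.2 + 1 = x + y := by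
  obtain ⟨d, hd, hd1, hc⟩ : ∃ d ∈ baseTriangle, d.1 + d.2 = 1 ∧ (x, y) - d ∈ cells := by
    by_contra! hnot
    have hle : cellInd x y ≤ 1 := Set.indicator_apply_le' (fun _ => le_rfl) fun _ => zero_le_one
    have hr : (x - 1, y) ∉ cells := by simpa using hnot (1, 0) (by simp [baseTriangle]) rfl
    have hu : (x, y - 1) ∉ cells := by simpa using hnot (0, 1) (by simp [baseTriangle]) rfl
    have hcount := sumCells_cellInd_of_mem_plusVerts hv h
    rw [sumCells, cellInd_of_notMem hr, cellInd_of_notMem hu] at hcount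
    linarith
  have hadj := (plusGraph_adj_add_iff hd (e := (0, 0)) (Or.inl rfl)
    (by rintro rfl; simp at hd1)).2 hc
  rw [sub_add_cancel] at hadj
  exact ⟨_, hadj, by simp only [Prod.fst_add, Prod.snd_add, Prod.fst_sub, Prod.snd_sub]; omega⟩

/-! ### The graph metric -/

/-- The level `|x| + |y|` of a vertex; it is its distance from the origin. -/
def level (v : verts) : ℤ := (fold v).1 + (fold v).2

theorem level_origin : level origin = 0 := rfl

theorem level_nonneg (v : verts) : 0 ≤ level v := add_nonneg (abs_nonneg _) (abs_nonneg _)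

theorem eq_origin_of_level_eq_zero {v : verts} (h : level v = 0) : v = origin := by
  have hfold : 0 ≤ (fold v).1 ∧ 0 ≤ (fold v).2 := nonneg_of_mem_plusVerts (fold_mem_plusVerts v)
  rw [level] at h
  exact fold_eq_zero_iff.1 (Prod.ext (by dsimp; omega) (by dsimp; omega))

theorem level_le_of_adj {u v : verts} (h : SG.Adj u v) : level v ≤ level u + 1 := by
  obtain ⟨-, p, -, hu, hv⟩ := plusGraph_adj_iff.1 (plusGraph_adj_fold h)
  simp only [mem_baseTriangle, Prod.fst_sub, Prod.snd_sub] at hu hv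
  rw [level, level]
  omega

theorem level_le_of_walk {u v : verts} (p : SG.Walk u v) : level v ≤ level u + p.length := by
  induction p with
  | nil => simp
  | cons h p ih =>
    rw [SimpleGraph.Walk.length_cons]
    have := level_le_of_adj h
    omega

theorem exists_adj_level_add_one_eq {v : verts} (hv : v ≠ origin) :
    ∃ q, SG.Adj q v ∧ level q + 1 = level v := by
  obtain ⟨p, hadj, hp⟩ := exists_plusGraph_adj_add_one_eq (fold_mem_plusVerts v)
    (fold_eq_zero_iff.not.2 hv)
  obtain ⟨q, hq, hfold⟩ := exists_adj_fold_eq hadj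
  exact ⟨q, hq.symm, by rwa [level, hfold]⟩

theorem exists_walk_length_eq_level (v : verts) :
    ∃ p : SG.Walk origin v, (p.length : ℤ) = level v := by
  induction hn : (level v).toNat generalizing v with
  | zero =>
    have hnonneg := level_nonneg v
    obtain rfl := eq_origin_of_level_eq_zero (v := v) (by omega)
    exact ⟨.nil, rfl⟩
  | succ n ih =>
    have hv : v ≠ origin := by
      rintro rfl
      simp [level_origin] at hn
    obtain ⟨q, hadj, hq⟩ := exists_adj_level_add_one_eq hv
    obtain ⟨p, hp⟩ := ih q (by omega)
    exact ⟨p.concat hadj, by rw [SimpleGraph.Walk.length_concat]; omega⟩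

theorem preconnected_SG : SG.Preconnected := fun u v =>
  have hreach (v : verts) : SG.Reachable origin v :=
    (exists_walk_length_eq_level v).choose.reachable
  (hreach u).symm.trans (hreach v)

theorem mem_ball_iff {r : ℤ} {v : verts} : v ∈ ball r ↔ level v ≤ r := by
  obtain ⟨p, hp⟩ := exists_walk_length_eq_level v
  obtain ⟨q, hq⟩ := p.reachable.exists_walk_length_eq_dist
  have hle := level_le_of_walk q
  rw [level_origin, hq] at hle
  have hdist := SimpleGraph.dist_le p
  exact ⟨fun h => hle.trans (by linarith [h.2]), fun h => ⟨p.reachable, by omega⟩⟩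

theorem finite_ball (r : ℤ) : (ball r).Finite := by
  refine ((Set.finite_Icc (-r, -r) (r, r)).preimage Subtype.val_injective.injOn).subset
    fun v hv => ?_
  have hle : |v.1.1| + |v.1.2| ≤ r := mem_ball_iff.1 hv
  have := abs_nonneg v.1.1
  have := abs_nonneg v.1.2
  have hx := abs_le.1 (show |v.1.1| ≤ r by omega)
  have hy := abs_le.1 (show |v.1.2| ≤ r by omega)
  exact ⟨⟨hx.1, hy.1⟩, hx.2, hy.2⟩

theorem mem_innerBoundary_ball_iff {n : ℤ} {v : verts} :
    v ∈ innerBoundary (ball n) ↔ level v = n ∧ fold v ∈ cells := by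
  constructor
  · rintro ⟨hv, q, hq, hadj⟩
    rw [mem_ball_iff] at hv hq
    have hle := level_le_of_adj hadj
    exact ⟨by omega, mem_cells_of_adj_of_lt (plusGraph_adj_fold hadj) (hv.trans_lt (not_le.1 hq))⟩
  · rintro ⟨hn, hc⟩
    have hadj := (plusGraph_adj_add_iff (d := (0, 0)) (e := (1, 0)) (Or.inl rfl)
      (Or.inr (Or.inl rfl)) (by simp)).2 hc
    rw [Prod.mk_zero_zero, add_zero] at hadj
    obtain ⟨q, hq, hfold⟩ := exists_adj_fold_eq hadj
    refine ⟨mem_ball_iff.2 hn.le, q, fun hmem => ?_, hq⟩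
    rw [mem_ball_iff, level, hfold, Prod.fst_add, Prod.snd_add] at hmem
    rw [level] at hn
    omega

/-! ### The Laplacian -/

/-- The six vectors joining a vertex of the triangular lattice to its neighbours. -/
def directions : Finset (ℤ × ℤ) := {(1, 0), (0, 1), (-1, 0), (-1, 1), (0, -1), (1, -1)}

theorem sub_mem_directions_of_adj {u v : ℤ × ℤ} (h : fullGraph.Adj u v) :
    v - u ∈ directions := by
  have hsub {u v : ℤ × ℤ} (h : plusGraph.Adj u v) : v - u ∈ directions := by
    obtain ⟨hne, p, -, hu, hv⟩ := plusGraph_adj_iff.1 h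
    simp only [directions, mem_baseTriangle, Finset.mem_insert, Finset.mem_singleton, ne_eq,
      Prod.ext_iff, Prod.fst_sub, Prod.snd_sub] at *
    omega
  rcases fullGraph_adj_iff.1 h with h | h
  · exact hsub h
  · simpa [neg_add_eq_sub] using hsub h.symm

open Classical in
theorem ite_fullGraph_adj {u v : ℤ × ℤ} (z : ℝ) :
    (if fullGraph.Adj u v then z else 0) =
      (if plusGraph.Adj u v then z else 0) + if plusGraph.Adj (-u) (-v) then z else 0 := by
  rw [fullGraph_adj_iff]
  by_cases h : plusGraph.Adj u v
  · have h' : ¬plusGraph.Adj (-u) (-v) := fun h' => h.ne <|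
      (eq_zero_of_mem_of_neg_mem (mem_plusVerts_of_adj h) (mem_plusVerts_of_adj h')).trans
      (eq_zero_of_mem_of_neg_mem (mem_plusVerts_of_adj h.symm)
        (mem_plusVerts_of_adj h'.symm)).symm
    simp [h, h']
  · simp [h]

open Classical in
theorem sum_neighborFinset_eq_sum_directions (f : ℤ × ℤ → ℝ) (v : verts) :
    ∑ q ∈ SG.neighborFinset v, f q.1 =
      ∑ d ∈ directions, if fullGraph.Adj v.1 (v.1 + d) then f (v.1 + d) else 0 := by
  rw [← Finset.sum_filter]
  have hverts {d : ℤ × ℤ} (h : fullGraph.Adj v.1 (v.1 + d)) : v.1 + d ∈ verts := by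
    rw [mem_verts_iff]
    exact (fullGraph_adj_iff.1 h).imp (mem_plusVerts_of_adj ·.symm) (mem_plusVerts_of_adj ·.symm)
  refine Finset.sum_bij' (fun q _ => q.1 - v.1)
    (fun d hd => ⟨v.1 + d, hverts (Finset.mem_filter.1 hd).2⟩) (fun q hq => ?_) (fun d hd => ?_)
    (fun q _ => by simp) (fun d _ => by simp) fun q _ => by simp
  · rw [SimpleGraph.mem_neighborFinset] at hq
    exact Finset.mem_filter.2 ⟨sub_mem_directions_of_adj hq, by rwa [add_sub_cancel]⟩
  · rw [SimpleGraph.mem_neighborFinset]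
    exact (Finset.mem_filter.1 hd).2

/-- The sum of `f` over the neighbours of `(x, y)` in `SG⁺`, one summand for each cell. -/
noncomputable def plusNeighborSum (f : ℤ → ℤ → ℝ) (x y : ℤ) : ℝ :=
  cellInd x y * (f (x + 1) y + f x (y + 1)) +
    cellInd (x - 1) y * (f (x - 1) y + f (x - 1) (y + 1)) +
    cellInd x (y - 1) * (f x (y - 1) + f (x + 1) (y - 1))

open Classical in
theorem ite_plusGraph_adj {p d e : ℤ × ℤ} (hd : d ∈ baseTriangle) (he : e ∈ baseTriangle)
    (hne : d ≠ e) (z : ℝ) :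
    (if plusGraph.Adj (p + d) (p + e) then z else 0) = cellInd p.1 p.2 * z := by
  by_cases hp : p ∈ cells
  · rw [if_pos ((plusGraph_adj_add_iff hd he hne).2 hp), cellInd_of_mem hp, one_mul]
  · rw [if_neg (mt (plusGraph_adj_add_iff hd he hne).1 hp), cellInd_of_notMem hp, zero_mul]

open Classical in
theorem sum_directions_plusGraph_adj (f : ℤ → ℤ → ℝ) (p : ℤ × ℤ) :
    (∑ d ∈ directions, if plusGraph.Adj p (p + d) then f (p.1 + d.1) (p.2 + d.2) else 0) =
      plusNeighborSum f p.1 p.2 := by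
  have hite (c d : ℤ × ℤ) (hc : -c ∈ baseTriangle) (hd : d - c ∈ baseTriangle) (hne : d ≠ 0)
      (z : ℝ) : (if plusGraph.Adj p (p + d) then z else 0) =
        cellInd (p.1 + c.1) (p.2 + c.2) * z := by
    have := ite_plusGraph_adj (p := p + c) hc hd (fun h => hne (by simpa using h.symm)) z
    simpa using this
  rw [directions]
  iterate 5 rw [Finset.sum_insert (by decide)]
  rw [Finset.sum_singleton]
  rw [hite (0, 0) (1, 0), hite (0, 0) (0, 1), hite (-1, 0) (-1, 0), hite (-1, 0) (-1, 1),
    hite (0, -1) (0, -1), hite (0, -1) (1, -1)]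
  · simp only [plusNeighborSum, add_zero, ← sub_eq_add_neg]
    ring
  all_goals simp [mem_baseTriangle]

open Classical in
theorem sum_neighborFinset (f : ℤ → ℤ → ℝ) (v : verts) :
    ∑ q ∈ SG.neighborFinset v, f q.1.1 q.1.2 = plusNeighborSum f v.1.1 v.1.2 +
      plusNeighborSum (fun a b => f (-a) (-b)) (-v.1.1) (-v.1.2) := by
  have hneg : ∑ d ∈ directions,
      (if plusGraph.Adj (-v.1) (-(v.1 + d)) then f (v.1.1 + d.1) (v.1.2 + d.2) else 0) =
      plusNeighborSum (fun a b => f (-a) (-b)) (-v.1.1) (-v.1.2) := by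
    have h := sum_directions_plusGraph_adj (fun a b => f (-a) (-b)) (-v.1)
    rw [← Prod.fst_neg, ← Prod.snd_neg, ← h]
    refine Finset.sum_nbij' (fun d => -d) (fun d => -d) (by decide) (by decide) (by simp) (by simp)
      fun d _ => ?_
    simp [add_comm]
  rw [sum_neighborFinset_eq_sum_directions fun q => f q.1 q.2]
  simp only [ite_fullGraph_adj, Finset.sum_add_distrib, Prod.fst_add, Prod.snd_add]
  rw [hneg, sum_directions_plusGraph_adj]

theorem triLap_eq (f : ℤ → ℤ → ℝ) (x y : ℤ) :
    triLap f x y = plusNeighborSum f x y - 2 * sumCells cellInd x y * f x y := by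
  simp only [triLap, plusNeighborSum, sumCells, sub_add_cancel]
  ring

theorem sumCells_cellInd_of_notMem {x y : ℤ} (h : (x, y) ∉ plusVerts) :
    sumCells cellInd x y = 0 := by
  rw [mem_plusVerts_iff_cells, not_or, not_or] at h
  rw [sumCells, cellInd_of_notMem h.1, cellInd_of_notMem h.2.1, cellInd_of_notMem h.2.2]
  norm_num

theorem sumCells_cellInd_add_neg (v : verts) :
    sumCells cellInd v.1.1 v.1.2 + sumCells cellInd (-v.1.1) (-v.1.2) = 2 := by
  by_cases hv : v = origin
  · rw [hv, origin, neg_zero, sumCells_cellInd_zero]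
    norm_num
  have hfold : sumCells cellInd (fold v).1 (fold v).2 = 2 :=
    sumCells_cellInd_of_mem_plusVerts (fold_mem_plusVerts v) (fold_eq_zero_iff.not.2 hv)
  rcases fold_eq_or hv with ⟨h, hneg⟩ | ⟨h, hneg⟩
  · have hzero : sumCells cellInd (-v.1.1) (-v.1.2) = 0 := sumCells_cellInd_of_notMem hneg
    rw [hzero, add_zero, ← hfold, h]
  · rw [sumCells_cellInd_of_notMem hneg, zero_add, ← hfold, h, Prod.fst_neg, Prod.snd_neg]

theorem degree_eq_four (v : verts) : SG.degree v = 4 := by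
  have hsum := sum_neighborFinset (fun _ _ => 1) v
  have hcount (x y : ℤ) : plusNeighborSum (fun _ _ => 1) x y = 2 * sumCells cellInd x y := by
    simp only [plusNeighborSum, sumCells]
    ring
  rw [hcount, hcount, ← mul_add, sumCells_cellInd_add_neg, Finset.sum_const, nsmul_one,
    SimpleGraph.card_neighborFinset_eq_degree] at hsum
  norm_num at hsum
  exact_mod_cast hsum

theorem laplacian_eq (f : ℤ → ℤ → ℝ) (v : verts) :
    laplacian (fun q => f q.1.1 q.1.2) v = 1 / 4 * (triLap f v.1.1 v.1.2 +
      triLap (fun a b => f (-a) (-b)) (-v.1.1) (-v.1.2)) := by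
  rw [laplacian, sum_neighborFinset, triLap_eq, triLap_eq, neg_neg, neg_neg]
  linear_combination f v.1.1 v.1.2 / 2 * sumCells_cellInd_add_neg v

theorem triLap_of_notMem (u : ℤ → ℤ → ℝ) {x y : ℤ} (h : (x, y) ∉ plusVerts) :
    triLap u x y = 0 := by
  rw [mem_plusVerts_iff_cells, not_or, not_or] at h
  simp [triLap, sumCells, cellInd_of_notMem, h]

theorem triLap_abs (u : ℤ → ℤ → ℝ) {x y : ℤ} (hx : 0 ≤ x) (hy : 0 ≤ y) :
    triLap (fun a b => u |a| |b|) x y = triLap u x y := by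
  have hcell (a b : ℤ) : cellInd a b * (u |a| |b| + u |a + 1| |b| + u |a| |b + 1| - 3 * u x y) =
      cellInd a b * (u a b + u (a + 1) b + u a (b + 1) - 3 * u x y) := by
    by_cases h : (a, b) ∈ cells
    · obtain ⟨ha, hb⟩ := nonneg_of_mem_cells h
      rw [abs_of_nonneg ha, abs_of_nonneg hb, abs_of_nonneg (by omega : 0 ≤ a + 1),
        abs_of_nonneg (by omega : 0 ≤ b + 1)]
    · rw [cellInd_of_notMem h, zero_mul, zero_mul]
  simp only [triLap, abs_of_nonneg hx, abs_of_nonneg hy, hcell]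

theorem laplacian_comp_fold (u : ℤ → ℤ → ℝ) {v : verts} (hv : v ≠ origin) :
    laplacian (fun q => u (fold q).1 (fold q).2) v = 1 / 4 * triLap u (fold v).1 (fold v).2 := by
  rw [← triLap_abs u (x := (fold v).1) (y := (fold v).2) (abs_nonneg _) (abs_nonneg _)]
  refine (laplacian_eq (fun a b => u |a| |b|) v).trans ?_
  simp only [abs_neg]
  rcases fold_eq_or hv with ⟨h, hneg⟩ | ⟨h, hneg⟩
  · have hzero : triLap (fun a b => u |a| |b|) (-v.1.1) (-v.1.2) = 0 := triLap_of_notMem _ hneg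
    rw [h, hzero, add_zero]
  · rw [triLap_of_notMem _ hneg, zero_add, h, Prod.fst_neg, Prod.snd_neg]

theorem sum_laplacian_eq_zero {S : Finset verts} {U : verts → ℝ}
    (h : ∀ v, U v ≠ 0 → v ∈ S ∧ ∀ q, SG.Adj v q → q ∈ S) : ∑ v ∈ S, laplacian U v = 0 := by
  classical
  have hrow (v : verts) :
      ∑ q ∈ SG.neighborFinset v, U q = ∑ q ∈ S, if SG.Adj v q then U q else 0 := by
    rw [← Finset.sum_filter]
    refine (Finset.sum_subset (fun q hq => ?_) fun q hq hq' => ?_).symm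
    · simpa using (Finset.mem_filter.1 hq).2
    · by_contra hU
      exact hq' (Finset.mem_filter.2 ⟨(h q hU).1, by simpa using hq⟩)
  have hcol (q : verts) : (∑ v ∈ S, if SG.Adj v q then U q else 0) = 4 * U q := by
    by_cases hU : U q = 0
    · simp [hU]
    have hfilter : S.filter (SG.Adj · q) = SG.neighborFinset q := by
      ext v
      simp only [Finset.mem_filter, SimpleGraph.mem_neighborFinset, SG.adj_comm v q]
      exact ⟨And.right, fun hv => ⟨(h q hU).2 v hv, hv⟩⟩
    rw [← Finset.sum_filter, hfilter, Finset.sum_const, SimpleGraph.card_neighborFinset_eq_degree,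
      degree_eq_four, nsmul_eq_mul, Nat.cast_ofNat]
  simp only [laplacian, hrow]
  rw [Finset.sum_sub_distrib, ← Finset.mul_sum, Finset.sum_comm]
  simp only [hcol]
  rw [← Finset.mul_sum]
  ring

/-! ### Odometers of balls -/

/-- The density of mass `1` on the ball `B_r`, halved on its inner boundary; its total mass is
`ballMass r`. -/
noncomputable def ballDensity (r : ℤ) (v : verts) : ℝ :=
  (ball r).indicator 1 v - 1 / 2 * (innerBoundary (ball r)).indicator 1 v

theorem ballDensity_le_one (r : ℤ) (v : verts) : ballDensity r v ≤ 1 := by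
  have hball : (ball r).indicator (1 : verts → ℝ) v ≤ 1 :=
    Set.indicator_le_self' (fun _ _ => zero_le_one) v
  have hbdry : 0 ≤ (innerBoundary (ball r)).indicator (1 : verts → ℝ) v :=
    Set.indicator_nonneg (fun _ _ => zero_le_one) v
  rw [ballDensity]
  linarith

theorem ballDensity_eq_one {r : ℤ} {v : verts} (h : level v < r) : ballDensity r v = 1 := by
  rw [ballDensity, Set.indicator_of_mem (mem_ball_iff.2 h.le),
    Set.indicator_of_notMem fun hv => h.ne (mem_innerBoundary_ball_iff.1 hv).1]
  simp

theorem sum_ballDensity {n : ℕ} {S : Finset verts} (h : ball n ⊆ S) :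
    ∑ v ∈ S, ballDensity n v = ballMass n := by
  have hcard {A : Set verts} (hA : A ⊆ S) :
      ∑ v ∈ S, A.indicator (1 : verts → ℝ) v = A.ncard := by
    lift A to Finset verts using S.finite_toSet.subset hA
    rw [Finset.sum_indicator_subset _ (Finset.coe_subset.1 hA), Set.ncard_coe_finset]
    simp
  simp only [ballDensity]
  rw [Finset.sum_sub_distrib, ← Finset.mul_sum, hcard h, hcard fun v hv => h hv.1, ballMass]

theorem cellsBelow_fold (r : ℤ) {v : verts} (hv : v ≠ origin) :
    cellsBelow r (fold v).1 (fold v).2 = 2 * ballDensity r v := by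
  have htwo : sumCells cellInd (fold v).1 (fold v).2 = 2 :=
    sumCells_cellInd_of_mem_plusVerts (fold_mem_plusVerts v) (fold_eq_zero_iff.not.2 hv)
  have hlevel : (fold v).1 + (fold v).2 = level v := rfl
  rw [cellsBelow, sumCells, sub_add_eq_add_sub, ← add_sub_assoc, hlevel]
  rcases lt_trichotomy (level v) r with h | h | h
  · rw [if_pos h, if_pos (by omega), if_pos (by omega), ballDensity_eq_one h, mul_one]
    exact htwo
  · have hbdry : (innerBoundary (ball r)).indicator 1 v = cellInd (fold v).1 (fold v).2 :=
      Set.indicator_const_eq_indicator_const (mem_innerBoundary_ball_iff.trans (and_iff_right h))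
    rw [if_neg h.not_lt, if_pos (by omega), if_pos (by omega), ballDensity, hbdry,
      Set.indicator_of_mem (mem_ball_iff.2 h.le)]
    rw [sumCells] at htwo
    rw [Pi.one_apply]
    linarith
  · have hball : v ∉ ball r := fun hv => h.not_ge (mem_ball_iff.1 hv)
    rw [if_neg (by omega), if_neg (by omega), if_neg (by omega), ballDensity,
      Set.indicator_of_notMem hball, Set.indicator_of_notMem fun hv => hball hv.1]
    norm_num

/-- `U` is the odometer of the sandpile that spreads mass `ballMass n` from the origin over the ball
`B_n` with density `ballDensity n`. -/
structure IsBallOdometer (n : ℕ) (U : verts → ℝ) : Prop where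
  pos : ∀ v, level v < n → 0 < U v
  eq_zero : ∀ v, (n : ℤ) ≤ level v → U v = 0
  laplacian_eq : ∀ v, laplacian U v =
    ballDensity n v - (Pi.single origin (ballMass n) : verts → ℝ) v

theorem laplacian_origin_of_laplacian_eq_ballDensity {n : ℕ} {U : verts → ℝ}
    (hzero : ∀ v, (n : ℤ) ≤ level v → U v = 0)
    (hlap : ∀ v ≠ origin, laplacian U v = ballDensity n v) :
    laplacian U origin = ballDensity n origin - ballMass n := by
  classical
  set S := (finite_ball (n + 1)).toFinset
  have hmem (v : verts) : v ∈ S ↔ level v ≤ n + 1 := by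
    rw [Set.Finite.mem_toFinset, mem_ball_iff]
  have hsum : ∑ v ∈ S, laplacian U v = 0 := sum_laplacian_eq_zero fun v hv => by
    have hlt : level v < n := not_le.1 fun h => hv (hzero v h)
    refine ⟨(hmem v).2 (by omega), fun q hq => (hmem q).2 ?_⟩
    have := level_le_of_adj hq
    omega
  have hmass : ∑ v ∈ S, ballDensity n v = ballMass n :=
    sum_ballDensity fun v hv => (hmem v).2 (by have := mem_ball_iff.1 hv; omega)
  have horigin : origin ∈ S := (hmem _).2 (by rw [level_origin]; omega)
  rw [← Finset.add_sum_erase _ _ horigin] at hsum hmass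
  rw [Finset.sum_congr rfl fun v hv => hlap v (Finset.ne_of_mem_erase hv)] at hsum
  linarith

theorem exists_isBallOdometer (n : ℕ) : ∃ U, IsBallOdometer n U := by
  obtain ⟨u, hu⟩ := exists_isLevelFun n
  have hzero (v : verts) (hv : (n : ℤ) ≤ level v) : u (fold v).1 (fold v).2 = 0 :=
    hu.eq_zero (fold_mem_plusVerts v) hv
  have hlap (v : verts) (hv : v ≠ origin) :
      laplacian (fun q => u (fold q).1 (fold q).2) v = ballDensity n v := by
    have hne : ((fold v).1, (fold v).2) ≠ (0, 0) := fold_eq_zero_iff.not.2 hv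
    rw [laplacian_comp_fold u hv, hu.triLap_eq hne, cellsBelow_fold n hv]
    ring
  refine ⟨fun v => u (fold v).1 (fold v).2, fun v hv => ?_, hzero, fun v => ?_⟩
  · have hle := hu.le (x := (fold v).1) (y := (fold v).2) (fold_mem_plusVerts v)
    have hpos : (0 : ℝ) < 2 * (n - level v) := by
      have : (level v : ℝ) < n := by exact_mod_cast hv
      linarith
    rw [level] at hpos
    push_cast at hle hpos
    linarith
  · by_cases hv : v = origin
    · rw [hv, Pi.single_eq_same]
      exact laplacian_origin_of_laplacian_eq_ballDensity hzero hlap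
    · rw [hlap v hv, Pi.single_eq_of_ne hv, sub_zero]

theorem ballMass_zero : ballMass 0 = 1 / 2 := by
  have hball : ball (0 : ℕ) = {origin} := by
    ext v
    rw [mem_ball_iff, Set.mem_singleton_iff]
    refine ⟨fun h => eq_origin_of_level_eq_zero (le_antisymm h (level_nonneg v)), ?_⟩
    rintro rfl
    exact level_origin.le
  have hbdry : innerBoundary (ball (0 : ℕ)) = {origin} := by
    refine Set.Subset.antisymm (fun v hv => hball ▸ hv.1) ?_
    rintro _ rfl
    exact mem_innerBoundary_ball_iff.2 ⟨level_origin, zero_mem_cells⟩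
  rw [ballMass, hbdry, hball, Set.ncard_singleton]
  norm_num

/-- The vertex `(j, 0)` on the horizontal axis of the gasket. -/
def axisVertex (j : ℕ) : verts :=
  ⟨(j, 0), mem_verts_iff.2 (Or.inl (mem_plusVerts_iff_cells.2 (Or.inl (axis_mem_cells j))))⟩

theorem level_axisVertex (j : ℕ) : level (axisVertex j) = j := by
  simp [level, fold, axisVertex]

theorem axisVertex_injective : Function.Injective axisVertex := fun i j hij => by
  have := congrArg level hij
  rwa [level_axisVertex, level_axisVertex, Nat.cast_inj] at this

instance : Infinite verts := .of_injective axisVertex axisVertex_injective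

theorem add_one_div_two_le_ballMass (n : ℕ) : ((n : ℝ) + 1) / 2 ≤ ballMass n := by
  have haxis : axisVertex '' Set.Iic n ⊆ ball n := by
    rintro _ ⟨j, hj, rfl⟩
    rw [mem_ball_iff, level_axisVertex]
    exact_mod_cast hj
  have hball := Set.ncard_le_ncard haxis (finite_ball n)
  rw [Set.ncard_image_of_injective _ axisVertex_injective, Set.ncard_eq_toFinset_card',
    Set.toFinset_Iic, Nat.card_Iic] at hball
  have hbdry : (innerBoundary (ball n)).ncard ≤ (ball n).ncard :=
    Set.ncard_le_ncard (fun v hv => hv.1) (finite_ball n)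
  have hball' : (n : ℝ) + 1 ≤ (ball n).ncard := by exact_mod_cast hball
  have hbdry' : ((innerBoundary (ball n)).ncard : ℝ) ≤ (ball n).ncard := by exact_mod_cast hbdry
  rw [ballMass]
  linarith

theorem tendsto_ballMass_atTop : Tendsto ballMass atTop atTop :=
  tendsto_atTop_mono add_one_div_two_le_ballMass <|
    (tendsto_natCast_atTop_atTop.atTop_add tendsto_const_nhds).atTop_div_const two_pos

theorem exists_isGreatest_ballMass_le {m : ℝ} (hm : 1 / 2 ≤ m) :
    ∃ n, IsGreatest {k | ballMass k ≤ m} n := by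
  have hfin : {k | ballMass k ≤ m}.Finite := by
    have := tendsto_ballMass_atTop.eventually_gt_atTop m
    rw [← Nat.cofinite_eq_atTop, eventually_cofinite] at this
    simpa only [not_lt] using this
  exact hfin.bddAbove.exists_isGreatest_of_nonempty ⟨0, ballMass_zero.trans_le hm⟩

/-! ### The least action principle -/

/-- `w` is a competitor of the odometer in the least action principle: it is nonnegative, and
emitting the mass `w` lowers the sand `μ₀` to at most `h`. -/
structure IsStabilizing (h μ₀ w : verts → ℝ) : Prop where
  nonneg : ∀ v, 0 ≤ w v
  laplacian_add_le : ∀ v, laplacian w v + μ₀ v ≤ h v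

theorem laplacian_single_self (x : verts) : laplacian (Pi.single x 1) x = -1 := by
  have hsum : ∑ y ∈ SG.neighborFinset x, (Pi.single x (1 : ℝ) : verts → ℝ) y = 0 :=
    Finset.sum_eq_zero fun y hy => Pi.single_eq_of_ne
      (SG.ne_of_adj ((SG.mem_neighborFinset x y).1 hy)).symm _
  rw [laplacian, hsum, Pi.single_eq_same]
  norm_num

theorem laplacian_add_smul (f g : verts → ℝ) (a : ℝ) (v : verts) :
    laplacian (f + a • g) v = laplacian f v + a * laplacian g v := by
  simp only [laplacian, Pi.add_apply, Pi.smul_apply, smul_eq_mul, Finset.sum_add_distrib,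
    ← Finset.mul_sum]
  ring

theorem partialOdometer_zero (h μ₀ : verts → ℝ) (x : ℕ → verts) :
    partialOdometer h μ₀ x 0 = 0 := by
  ext y
  simp [partialOdometer]

theorem partialOdometer_succ (h μ₀ : verts → ℝ) (x : ℕ → verts) (k : ℕ) :
    partialOdometer h μ₀ x (k + 1) = partialOdometer h μ₀ x k +
      max (sand h μ₀ x k (x k) - h (x k)) 0 • Pi.single (x k) 1 := by
  ext y
  simp only [partialOdometer, Finset.sum_filter, Finset.sum_range_succ, Pi.add_apply,
    Pi.smul_apply, smul_eq_mul]
  congr 1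
  split_ifs with hy
  · subst hy
    rw [sand, topple, laplacian_single_self, Pi.single_eq_same]
    ring
  · rw [Pi.single_eq_of_ne (Ne.symm hy), mul_zero]

theorem sand_eq (h μ₀ : verts → ℝ) (x : ℕ → verts) (k : ℕ) (y : verts) :
    sand h μ₀ x k y = μ₀ y + laplacian (partialOdometer h μ₀ x k) y := by
  induction k generalizing y with
  | zero => simp [sand, partialOdometer_zero, laplacian]
  | succ k ih =>
    rw [partialOdometer_succ, laplacian_add_smul, sand, topple, ih y]
    ring

theorem partialOdometer_succ_of_ne (h μ₀ : verts → ℝ) {x : ℕ → verts} {k : ℕ} {y : verts}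
    (hy : x k ≠ y) : partialOdometer h μ₀ x (k + 1) y = partialOdometer h μ₀ x k y := by
  rw [partialOdometer_succ, Pi.add_apply, Pi.smul_apply, Pi.single_eq_of_ne hy.symm, smul_zero,
    add_zero]

theorem partialOdometer_succ_self (h μ₀ : verts → ℝ) (x : ℕ → verts) (k : ℕ) :
    partialOdometer h μ₀ x (k + 1) (x k) = max (partialOdometer h μ₀ x k (x k))
      (μ₀ (x k) + 1 / 4 * ∑ q ∈ SG.neighborFinset (x k), partialOdometer h μ₀ x k q -
        h (x k)) := by
  rw [partialOdometer_succ, Pi.add_apply, Pi.smul_apply, Pi.single_eq_same, smul_eq_mul, mul_one,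
    sand_eq, laplacian, max_comm (_ - _), ← max_add_add_left]
  congr 1 <;> ring

theorem monotone_partialOdometer (h μ₀ : verts → ℝ) (x : ℕ → verts) (y : verts) :
    Monotone fun k => partialOdometer h μ₀ x k y := by
  refine monotone_nat_of_le_succ fun k => ?_
  by_cases hy : x k = y
  · subst hy
    rw [partialOdometer_succ_self]
    exact le_max_left _ _
  · exact (partialOdometer_succ_of_ne h μ₀ hy).ge

theorem partialOdometer_nonneg (h μ₀ : verts → ℝ) (x : ℕ → verts) (k : ℕ) (y : verts) :
    0 ≤ partialOdometer h μ₀ x k y := by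
  simpa only [partialOdometer_zero, Pi.zero_apply] using
    monotone_partialOdometer h μ₀ x y k.zero_le

theorem partialOdometer_le {h μ₀ w : verts → ℝ} (hw : IsStabilizing h μ₀ w) (x : ℕ → verts)
    (k : ℕ) (y : verts) : partialOdometer h μ₀ x k y ≤ w y := by
  induction k generalizing y with
  | zero => simpa [partialOdometer_zero] using hw.nonneg y
  | succ k ih =>
    by_cases hy : x k = y
    · subst hy
      rw [partialOdometer_succ_self]
      refine max_le (ih _) ?_
      have hlap := hw.laplacian_add_le (x k)
      rw [laplacian] at hlap
      have hsum := Finset.sum_le_sum fun q (_ : q ∈ SG.neighborFinset (x k)) => ih q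
      linarith
    · rw [partialOdometer_succ_of_ne h μ₀ hy]
      exact ih y

theorem laplacian_add_le_of_tendsto {h μ₀ u : verts → ℝ} {x : ℕ → verts} (hx : IsTopplingSeq x)
    (hlim : ∀ y, Tendsto (fun k => partialOdometer h μ₀ x k y) atTop (𝓝 (u y))) (y : verts) :
    laplacian u y + μ₀ y ≤ h y := by
  have hright : Tendsto (fun k => μ₀ y + 1 / 4 * ∑ q ∈ SG.neighborFinset y,
      partialOdometer h μ₀ x k q - h y) atTop
      (𝓝 (μ₀ y + 1 / 4 * ∑ q ∈ SG.neighborFinset y, u q - h y)) :=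
    (((tendsto_finsetSum _ fun q _ => hlim q).const_mul _).const_add _).sub_const _
  have hfreq : ∃ᶠ k in atTop, μ₀ y + 1 / 4 * ∑ q ∈ SG.neighborFinset y,
      partialOdometer h μ₀ x k q - h y ≤ partialOdometer h μ₀ x (k + 1) y := by
    refine (Nat.frequently_atTop_iff_infinite.2 (hx y)).mono ?_
    rintro k rfl
    rw [partialOdometer_succ_self]
    exact le_max_right _ _
  have hle := le_of_tendsto_of_tendsto_of_frequently hright
    ((hlim y).comp (tendsto_add_atTop_nat 1)) hfreq
  rw [laplacian]
  linarith

theorem exists_tendsto_partialOdometer {h μ₀ w : verts → ℝ} (hw : IsStabilizing h μ₀ w)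
    {x : ℕ → verts} (hx : IsTopplingSeq x) : ∃ u, IsStabilizing h μ₀ u ∧
      ∀ y, Tendsto (fun k => partialOdometer h μ₀ x k y) atTop (𝓝 (u y)) := by
  have hlim (y : verts) : Tendsto (fun k => partialOdometer h μ₀ x k y) atTop
      (𝓝 (⨆ k, partialOdometer h μ₀ x k y)) :=
    tendsto_atTop_ciSup (monotone_partialOdometer h μ₀ x y)
      ⟨w y, Set.forall_mem_range.2 fun k => partialOdometer_le hw x k y⟩
  exact ⟨_, ⟨fun y => ge_of_tendsto' (hlim y) fun k => partialOdometer_nonneg h μ₀ x k y,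
    laplacian_add_le_of_tendsto hx hlim⟩, hlim⟩

theorem exists_isOdometer {h μ₀ w : verts → ℝ} (hw : IsStabilizing h μ₀ w) :
    ∃ u, IsOdometer h μ₀ u ∧ IsStabilizing h μ₀ u ∧ ∀ w, IsStabilizing h μ₀ w → u ≤ w := by
  have hleast {x : ℕ → verts} {u w : verts → ℝ}
      (hlim : ∀ y, Tendsto (fun k => partialOdometer h μ₀ x k y) atTop (𝓝 (u y)))
      (hw : IsStabilizing h μ₀ w) : u ≤ w :=
    fun y => le_of_tendsto' (hlim y) fun k => partialOdometer_le hw x k y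
  obtain ⟨x, hx⟩ := exists_isTopplingSeq
  obtain ⟨u, hu, hlim⟩ := exists_tendsto_partialOdometer hw hx
  refine ⟨u, fun x' hx' => ?_, hu, fun w hw => hleast hlim hw⟩
  obtain ⟨u', hu', hlim'⟩ := exists_tendsto_partialOdometer hw hx'
  rwa [le_antisymm (hleast hlim hu') (hleast hlim' hu)]

/-! ### Comparison with the ball odometers -/

theorem eq_of_adj_of_laplacian_nonpos {f : verts → ℝ} {x y : verts} (hmin : ∀ q, f x ≤ f q)
    (hlap : laplacian f x ≤ 0) (hadj : SG.Adj x y) : f y = f x := by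
  have hsum : ∑ q ∈ SG.neighborFinset x, (f q - f x) ≤ 0 := by
    rw [laplacian] at hlap
    rw [Finset.sum_sub_distrib, Finset.sum_const, SimpleGraph.card_neighborFinset_eq_degree,
      degree_eq_four, nsmul_eq_mul, Nat.cast_ofNat]
    linarith
  have hnonneg : ∀ q ∈ SG.neighborFinset x, 0 ≤ f q - f x := fun q _ => sub_nonneg.2 (hmin q)
  exact sub_eq_zero.1 <| (Finset.sum_eq_zero_iff_of_nonneg hnonneg).1
    (hsum.antisymm (Finset.sum_nonneg hnonneg)) y ((SG.mem_neighborFinset x y).2 hadj)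

theorem nonneg_of_laplacian_nonpos {f : verts → ℝ} {S : Finset verts}
    (hout : ∀ v ∉ S, 0 ≤ f v) (hlap : ∀ v ∈ S, laplacian f v ≤ 0) : 0 ≤ f := by
  intro v
  by_contra! hv
  rw [Pi.zero_apply] at hv
  have hmem {q : verts} (hq : f q < 0) : q ∈ S := by
    by_contra hS
    exact hq.not_ge (hout q hS)
  obtain ⟨x, -, hx⟩ := S.exists_min_image f ⟨v, hmem hv⟩
  have hneg : f x < 0 := (hx v (hmem hv)).trans_lt hv
  have hmin (q : verts) : f x ≤ f q := by
    by_cases hq : q ∈ S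
    · exact hx q hq
    · exact hneg.le.trans (hout q hq)
  have hconst {y z : verts} (p : SG.Walk y z) (hy : f y = f x) : f z = f x := by
    induction p with
    | nil => exact hy
    | cons hadj _ ih =>
      exact ih ((eq_of_adj_of_laplacian_nonpos (fun q => hy.trans_le (hmin q))
        (hlap _ (hmem (hy.trans_lt hneg))) hadj).trans hy)
  obtain ⟨z, hz⟩ := Infinite.exists_notMem_finset S
  obtain ⟨p⟩ := preconnected_SG x z
  exact hz (hmem ((hconst p rfl).trans_lt hneg))

namespace IsBallOdometer

variable {n : ℕ} {m : ℝ} {U u : verts → ℝ}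

theorem isStabilizing (hU : IsBallOdometer n U) (hm : m ≤ ballMass n) :
    IsStabilizing (fun _ => 1) (Pi.single origin m) U := by
  refine ⟨fun v => ?_, fun v => ?_⟩
  · rcases lt_or_ge (level v) n with hv | hv
    exacts [(hU.pos v hv).le, (hU.eq_zero v hv).ge]
  · have hsingle : (Pi.single origin m : verts → ℝ) v ≤
        (Pi.single origin (ballMass n) : verts → ℝ) v := Pi.single_mono origin hm v
    have hdensity := ballDensity_le_one n v
    rw [hU.laplacian_eq]
    linarith

theorem le_of_isStabilizing (hU : IsBallOdometer n U) (hm : ballMass n ≤ m)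
    (hu : IsStabilizing (fun _ => 1) (Pi.single origin m) u) : U ≤ u := by
  refine sub_nonneg.1 (nonneg_of_laplacian_nonpos (S := (finite_ball (n - 1)).toFinset)
    (fun v hv => ?_) fun v hv => ?_)
  · rw [Set.Finite.mem_toFinset, mem_ball_iff] at hv
    simpa [hU.eq_zero v (by omega)] using hu.nonneg v
  · rw [Set.Finite.mem_toFinset, mem_ball_iff] at hv
    have hsingle : (Pi.single origin (ballMass n) : verts → ℝ) v ≤
        (Pi.single origin m : verts → ℝ) v := Pi.single_mono origin hm v
    have hlap := hu.laplacian_add_le v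
    have hsub := laplacian_add_smul u U (-1) v
    rw [neg_one_smul, ← sub_eq_add_neg, hU.laplacian_eq, ballDensity_eq_one (by omega)] at hsub
    linarith

end IsBallOdometer

theorem level_lt_of_mem_cluster {n : ℕ} {m : ℝ} {u : verts → ℝ} (hm : m ≤ ballMass n)
    (hu : ∀ w, IsStabilizing (fun _ => 1) (Pi.single origin m) w → u ≤ w) {v : verts}
    (hv : v ∈ cluster u) : level v < n := by
  obtain ⟨U, hU⟩ := exists_isBallOdometer n
  by_contra! hle
  exact hv.not_ge ((hu U (hU.isStabilizing hm) v).trans_eq (hU.eq_zero v hle))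

theorem mem_cluster_of_level_lt {n : ℕ} {m : ℝ} {u : verts → ℝ} (hm : ballMass n ≤ m)
    (hu : IsStabilizing (fun _ => 1) (Pi.single origin m) u) {v : verts} (hv : level v < n) :
    v ∈ cluster u := by
  obtain ⟨U, hU⟩ := exists_isBallOdometer n
  exact (hU.pos v hv).trans_le (hU.le_of_isStabilizing hm hu v)
end Gasket

theorem theorem1 (m : ℝ) (hm : 0 ≤ m) :
    ∃ u : Gasket.verts → ℝ,
      Gasket.IsOdometer (fun _ => 1) (Pi.single Gasket.origin m) u ∧
      (m < 1 / 2 → Gasket.cluster u = ∅) ∧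
      (1 / 2 ≤ m → ∃ n : ℕ, IsGreatest {k : ℕ | Gasket.ballMass k ≤ m} n ∧
        Gasket.ball ((n : ℤ) - 1) ⊆ Gasket.cluster u ∧
        Gasket.cluster u ⊆ Gasket.ball n) := by
  obtain ⟨N, hN⟩ := (Gasket.tendsto_ballMass_atTop.eventually_ge_atTop m).exists
  obtain ⟨U, hU⟩ := Gasket.exists_isBallOdometer N
  obtain ⟨u, hu, hstab, hleast⟩ := Gasket.exists_isOdometer (hU.isStabilizing hN)
  refine ⟨u, hu, fun hlt => ?_, fun hge => ?_⟩
  · refine Set.eq_empty_of_forall_notMem fun v hv => (Gasket.level_nonneg v).not_gt ?_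
    exact Gasket.level_lt_of_mem_cluster (Gasket.ballMass_zero.symm ▸ hlt.le) hleast hv
  · obtain ⟨n, hn⟩ := Gasket.exists_isGreatest_ballMass_le hge
    have hsucc : m < Gasket.ballMass (n + 1) := not_le.1 fun h => n.not_succ_le_self (hn.2 h)
    refine ⟨n, hn, fun v hv => ?_, fun v hv => ?_⟩
    · have hlevel := Gasket.mem_ball_iff.1 hv
      exact Gasket.mem_cluster_of_level_lt hn.1 hstab (by omega)
    · have hlevel := Gasket.level_lt_of_mem_cluster hsucc.le hleast hv
      exact Gasket.mem_ball_iff.2 (by omega)
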